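/- For $n\ge 1$ let $Br_n$ be the braid group with generators $\sigma_1,\dots,\sigma_{n-1}$ and relations $\sigma_i\sigma_j=\sigma_j\sigma_i$ for $|i-j|>1$ and $\sigma_i\sigma_{i+1}\sigma_i=\sigma_{i+1}\sigma_i\sigma_{i+1}$ for $1\le i\le n-2$. Let the singular braid monoid $SB_n$ be the monoid with generators $\sigma_i,\sigma_i^{-1},x_i$ ($1\le i\le n-1$) and relations $$\sigma_i\sigma_j=\sigma_j\sigma_i,\quad x_ix_j=x_jx_i\quad(|i-j|>1),\qquad x_i\sigma_j=\sigma_jx_i\quad(|i-j|\neq 1),$$ $$\sigma_i\sigma_{i+1}\sigma_i=\sigma_{i+1}\sigma_i\sigma_{i+1},\quad \sigma_i\sigma_{i+1}x_i=x_{i+1}\sigma_i\sigma_{i+1},\quad \sigma_{i+1}\sigma_ix_{i+1}=x_i\sigma_{i+1}\sigma_i,\quad \sigma_i\sigma_i^{-1}=\sigma_i^{-1}\sigma_i=1.$$ Let $\iota\colon Br_n\to SB_n$ be the canonical homomorphism $\sigma_i\mapsto\sigma_i$, and let $\Delta=\Pi_{n-1}\Pi_{n-2}\cdots\Pi_1\in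 Br_n$, where $\Pi_t=\sigma_1\sigma_2\cdots\sigma_t$. **Theorem.** (1) The monoid $SB_2$ is commutative and isomorphic to $\mathbb Z\oplus\mathbb Z^+$, where $\mathbb Z^+=\{0,1,2,\dots\}$ is the additive monoid of non-negative integers. (2) For every $n\ge 3$, the homomorphism $\iota$ is injective, so that $Br_n$ may be regarded as a subgroup of the monoid $SB_n$, and under this identification the center of $SB_n$ equals the center of $Br_n$: $Z(SB_n)=\iota(Z(Br_n))$. The center of $Br_n$ is the cyclic group generated by $\Delta^2$, so $Z(SB_n)=\{\iota(\Delta)^{2k} : k\in\mathbb Z\}$. -/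

import Mathlib

/-- The relators of Artin's presentation of the braid group on `n` strings; the generator
`σ_{i+1}` of the usual notation corresponds to the index `i : Fin (n - 1)`. -/
inductive BraidRelator (n : ℕ) : FreeGroup (Fin (n - 1)) → Prop
  | comm (i j : Fin (n - 1)) (h : 1 < |(i : ℤ) - (j : ℤ)|) :
      BraidRelator n
        ((FreeGroup.of i * FreeGroup.of j) * (FreeGroup.of j * FreeGroup.of i)⁻¹)
  | braid (i j : Fin (n - 1)) (h : (i : ℕ) + 1 = (j : ℕ)) :
      BraidRelator n
        ((FreeGroup.of i * FreeGroup.of j * FreeGroup.of i) *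
          (FreeGroup.of j * FreeGroup.of i * FreeGroup.of j)⁻¹)

/-- The braid group `Br_n` on `n` strings. -/
abbrev BraidGroup (n : ℕ) : Type :=
  PresentedGroup {r : FreeGroup (Fin (n - 1)) | BraidRelator n r}

/-- The standard generators of the braid group. -/
def BraidGroup.sigma {n : ℕ} (i : Fin (n - 1)) : BraidGroup n :=
  PresentedGroup.of i

/-- `Π_t = σ_1 σ_2 ⋯ σ_t` (for `t ≤ n - 1`). -/
def BraidGroup.prefixProd (n t : ℕ) : BraidGroup n :=
  (((List.finRange (n - 1)).take t).map BraidGroup.sigma).prod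

/-- Garside's fundamental element `Δ = Π_{n-1} Π_{n-2} ⋯ Π_1`. -/
def BraidGroup.fundamental (n : ℕ) : BraidGroup n :=
  ((List.range (n - 1)).reverse.map (fun t => BraidGroup.prefixProd n (t + 1))).prod

/-- The generators `σ_i`, `σ_i⁻¹`, `x_i` of the singular braid monoid. -/
inductive SingularBraidGen (n : ℕ) : Type
  | sigma (i : Fin (n - 1)) : SingularBraidGen n
  | sigmaInv (i : Fin (n - 1)) : SingularBraidGen n
  | x (i : Fin (n - 1)) : SingularBraidGen n

namespace SingularBraidGen

/-- The letter `σ_i` as a word. -/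
def wS {n : ℕ} (i : Fin (n - 1)) : FreeMonoid (SingularBraidGen n) :=
  FreeMonoid.of (sigma i)

/-- The letter `σ_i⁻¹` as a word. -/
def wSInv {n : ℕ} (i : Fin (n - 1)) : FreeMonoid (SingularBraidGen n) :=
  FreeMonoid.of (sigmaInv i)

/-- The letter `x_i` as a word. -/
def wX {n : ℕ} (i : Fin (n - 1)) : FreeMonoid (SingularBraidGen n) :=
  FreeMonoid.of (x i)

end SingularBraidGen

open SingularBraidGen in
/-- The defining relations of the singular braid monoid. -/
inductive SingularBraidRel (n : ℕ) :
    FreeMonoid (SingularBraidGen n) → FreeMonoid (SingularBraidGen n) → Prop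
  | sigma_comm (i j : Fin (n - 1)) (h : 1 < |(i : ℤ) - (j : ℤ)|) :
      SingularBraidRel n (wS i * wS j) (wS j * wS i)
  | x_comm (i j : Fin (n - 1)) (h : 1 < |(i : ℤ) - (j : ℤ)|) :
      SingularBraidRel n (wX i * wX j) (wX j * wX i)
  | x_sigma_comm (i j : Fin (n - 1)) (h : |(i : ℤ) - (j : ℤ)| ≠ 1) :
      SingularBraidRel n (wX i * wS j) (wS j * wX i)
  | braid (i j : Fin (n - 1)) (h : (i : ℕ) + 1 = (j : ℕ)) :
      SingularBraidRel n (wS i * wS j * wS i) (wS j * wS i * wS j)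
  | slide_right (i j : Fin (n - 1)) (h : (i : ℕ) + 1 = (j : ℕ)) :
      SingularBraidRel n (wS i * wS j * wX i) (wX j * wS i * wS j)
  | slide_left (i j : Fin (n - 1)) (h : (i : ℕ) + 1 = (j : ℕ)) :
      SingularBraidRel n (wS j * wS i * wX j) (wX i * wS j * wS i)
  | mul_inv (i : Fin (n - 1)) : SingularBraidRel n (wS i * wSInv i) 1
  | inv_mul (i : Fin (n - 1)) : SingularBraidRel n (wSInv i * wS i) 1

/-- The singular braid monoid (Baez--Birman monoid) `SB_n` on `n` strings. -/
abbrev SingularBraidMonoid (n : ℕ) : Type :=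
  PresentedMonoid (SingularBraidRel n)

namespace SingularBraidMonoid

theorem mk_eq_mk {n : ℕ} {a b : FreeMonoid (SingularBraidGen n)}
    (h : SingularBraidRel n a b) :
    PresentedMonoid.mk (SingularBraidRel n) a = PresentedMonoid.mk (SingularBraidRel n) b :=
  (Con.eq _).2 (ConGen.Rel.of _ _ h)

/-- The generator `σ_i` as a unit of the singular braid monoid. -/
def sigmaUnit {n : ℕ} (i : Fin (n - 1)) : (SingularBraidMonoid n)ˣ where
  val := PresentedMonoid.mk (SingularBraidRel n) (SingularBraidGen.wS i)
  inv := PresentedMonoid.mk (SingularBraidRel n) (SingularBraidGen.wSInv i)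
  val_inv := by
    rw [← map_mul, mk_eq_mk (SingularBraidRel.mul_inv i), map_one]
  inv_val := by
    rw [← map_mul, mk_eq_mk (SingularBraidRel.inv_mul i), map_one]

theorem lift_sigmaUnit_eq_one {n : ℕ} :
    ∀ r ∈ {r : FreeGroup (Fin (n - 1)) | BraidRelator n r},
      FreeGroup.lift (sigmaUnit (n := n)) r = 1 := by
  rintro r (⟨i, j, h⟩ | ⟨i, j, h⟩)
  · simp only [map_mul, map_inv, FreeGroup.lift_apply_of]
    rw [mul_inv_eq_one]
    ext
    simpa only [Units.val_mul, sigmaUnit, map_mul] using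
      mk_eq_mk (SingularBraidRel.sigma_comm i j h)
  · simp only [map_mul, map_inv, FreeGroup.lift_apply_of]
    rw [mul_inv_eq_one]
    ext
    simpa only [Units.val_mul, sigmaUnit, map_mul] using
      mk_eq_mk (SingularBraidRel.braid i j h)

/-- The canonical homomorphism `Br_n → SB_n`, `σ_i ↦ σ_i`. -/
def ofBraid (n : ℕ) : BraidGroup n →* SingularBraidMonoid n :=
  (Units.coeHom (SingularBraidMonoid n)).comp
    (PresentedGroup.toGroup (lift_sigmaUnit_eq_one (n := n)))

end SingularBraidMonoid

/-! The element `Δ ^ 2` is central because moving `Δ` past a generator, ordinary or singular,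
reverses the index (`garside_mul`). The computation uses only positive relations, so it is carried
out once in an arbitrary monoid and serves both `Br_n` and `SB_n`.

That nothing else is central in `Br_n` follows by induction on `n`. Braids fixing the first position
embed in the semidirect product of a free group and `Br_{n-1}`, the latter acting by Artin's
automorphisms: `toPointed` is the map, read off from an induced representation, and `ofPointed`
recovers the braid. For central `z`, the `Br_{n-1}` component is central and fixes the first
position, hence is a power of `Δ ^ 2`. Dividing by the same power in `Br_n` leaves an element of the
free group commuting with two different free generators, hence trivial
(`mem_zpowers_of_mem_center`).

Sending every `x_i` to `1` retracts `SB_n` onto `Br_n`, so `ofBraid` is injective. To keep singular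
elements out of the center, `SB_n` acts on sets of braids: braids conjugate and `x_i` inserts `σ_i`.
Applied to `∅`, a singular element gives a finite set containing a conjugate of `σ_1`. If the
element were central, this set would be invariant under conjugation, but for `n ≥ 3` the conjugacy
class of `σ_1` is infinite (`center_le_range`). For `n = 2`, exponent sum and number of singular
points are complete invariants. -/

/-! ### Garside's element from the positive relations -/

/-- Elements `s i`, `x i` (`i < m`) of a monoid satisfying the positive relations of the singular
braid monoid. -/
structure IsSingularBraidFamily {M : Type*} [Monoid M] (m : ℕ) (s x : ℕ → M) : Prop where
  comm : ∀ i j, i + 1 < j → j < m → s i * s j = s j * s i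
  xcomm : ∀ i j, i + 1 < j ∨ j + 1 < i ∨ i = j → i < m → j < m → x i * s j = s j * x i
  slide_right : ∀ i, i + 1 < m → s i * s (i + 1) * x i = x (i + 1) * s i * s (i + 1)
  slide_left : ∀ i, i + 1 < m → s (i + 1) * s i * x (i + 1) = x i * s (i + 1) * s i

/-- The increasing product `s 0 * s 1 * ⋯ * s (t - 1)`. -/
def ascProd {M : Type*} [Monoid M] (s : ℕ → M) : ℕ → M
  | 0 => 1
  | t + 1 => ascProd s t * s t

/-- The decreasing product `s (t - 1) * ⋯ * s 1 * s 0`. -/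
def descProd {M : Type*} [Monoid M] (s : ℕ → M) : ℕ → M
  | 0 => 1
  | t + 1 => s t * descProd s t

/-- Garside's element on the first `t` generators. -/
def garside {M : Type*} [Monoid M] (s : ℕ → M) : ℕ → M
  | 0 => 1
  | t + 1 => ascProd s (t + 1) * garside s t

section

variable {M N : Type*} [Monoid M] [Monoid N] {m : ℕ} {s x : ℕ → M}

theorem commute_ascProd {y : M} (t : ℕ) (h : ∀ i < t, Commute y (s i)) :
    Commute y (ascProd s t) := by
  induction t with
  | zero => exact Commute.one_right y
  | succ t ih =>
    exact (ih fun i hi => h i (by omega)).mul_right (h t (by omega))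

theorem commute_descProd {y : M} (t : ℕ) (h : ∀ i < t, Commute y (s i)) :
    Commute y (descProd s t) := by
  induction t with
  | zero => exact Commute.one_right y
  | succ t ih =>
    exact (h t (by omega)).mul_right (ih fun i hi => h i (by omega))

theorem commute_garside {y : M} (t : ℕ) (h : ∀ i < t, Commute y (s i)) :
    Commute y (garside s t) := by
  induction t with
  | zero => exact Commute.one_right y
  | succ t ih =>
    exact (commute_ascProd (t + 1) h).mul_right (ih fun i hi => h i (by omega))

theorem map_ascProd (f : M →* N) (t : ℕ) : f (ascProd s t) = ascProd (fun i => f (s i)) t := by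
  induction t with
  | zero => simp [ascProd]
  | succ t ih => simp [ascProd, ih]

theorem map_garside (f : M →* N) (t : ℕ) : f (garside s t) = garside (fun i => f (s i)) t := by
  induction t with
  | zero => simp [garside]
  | succ t ih => simp [garside, ih, map_ascProd]

theorem ascProd_congr {s' : ℕ → M} (t : ℕ) (h : ∀ i < t, s i = s' i) :
    ascProd s t = ascProd s' t := by
  induction t with
  | zero => rfl
  | succ t ih => simp only [ascProd, ih fun i hi => h i (by omega), h t (by omega)]

theorem garside_congr {s' : ℕ → M} (t : ℕ) (h : ∀ i < t, s i = s' i) :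
    garside s t = garside s' t := by
  induction t with
  | zero => rfl
  | succ t ih => simp only [garside, ih fun i hi => h i (by omega), ascProd_congr (t + 1) h]

namespace IsSingularBraidFamily

/-- Only the factors `s i * s (i + 1)` interact with the singular generator, through a slide
relation. Factors to their right commute with `x i`, factors to their left with `x (i + 1)`. -/
theorem ascProd_mul (h : IsSingularBraidFamily m s x) {t : ℕ} (ht : t ≤ m) {i : ℕ}
    (hi : i + 1 < t) : ascProd s t * x i = x (i + 1) * ascProd s t := by
  induction t with
  | zero => omega
  | succ t ih =>
    rcases Nat.lt_or_ge (i + 1) t with hit | hit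
    · rw [ascProd, mul_assoc, ← h.xcomm i t (by omega) (by omega) (by omega), ← mul_assoc,
        ih (by omega) hit, mul_assoc]
    · obtain rfl : t = i + 1 := by omega
      have hc : Commute (x (i + 1)) (ascProd s i) := commute_ascProd i fun j hj =>
        h.xcomm _ _ (by omega) (by omega) (by omega)
      rw [ascProd, ascProd, mul_assoc (ascProd s i), mul_assoc, h.slide_right i (by omega),
        mul_assoc (x (i + 1)), ← mul_assoc, ← hc.eq, mul_assoc]

theorem descProd_mul (h : IsSingularBraidFamily m s x) {t : ℕ} (ht : t ≤ m) {i : ℕ}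
    (hi : i + 1 < t) : descProd s t * x (i + 1) = x i * descProd s t := by
  induction t with
  | zero => omega
  | succ t ih =>
    rcases Nat.lt_or_ge (i + 1) t with hit | hit
    · rw [descProd, mul_assoc, ih (by omega) hit, ← mul_assoc,
        ← h.xcomm i t (by omega) (by omega) (by omega), mul_assoc]
    · obtain rfl : t = i + 1 := by omega
      have hc : Commute (x (i + 1)) (descProd s i) := commute_descProd i fun j hj =>
        h.xcomm _ _ (by omega) (by omega) (by omega)
      rw [descProd, descProd, mul_assoc, mul_assoc, ← hc.eq, ← mul_assoc, ← mul_assoc,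
        h.slide_left i (by omega)]
      simp only [mul_assoc]

/-- The new last generator commutes with the smaller Garside element two steps down, so it can be
moved from the ascending product into a descending one. This second factorization handles the
generator that `ascProd_mul` does not reach. -/
theorem garside_succ (h : IsSingularBraidFamily m s x) {t : ℕ} (ht : t < m) :
    garside s (t + 1) = garside s t * descProd s (t + 1) := by
  induction t with
  | zero => simp [garside, ascProd, descProd]
  | succ t ih =>
    have hc : Commute (s (t + 1)) (garside s t) := commute_garside t fun j hj =>
      (h.comm j (t + 1) (by omega) (by omega)).symm
    calc garside s (t + 2)
        = ascProd s (t + 1) * s (t + 1) * (garside s t * descProd s (t + 1)) := by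
          rw [← ih (by omega)]; rfl
      _ = ascProd s (t + 1) * (s (t + 1) * garside s t) * descProd s (t + 1) := by
          simp only [mul_assoc]
      _ = ascProd s (t + 1) * garside s t * (s (t + 1) * descProd s (t + 1)) := by
          rw [hc.eq]; simp only [mul_assoc]
      _ = _ := rfl

/-- For `i < t` the smaller Garside element reverses the index and the ascending product then shifts
it up. For the last generator the descending product first shifts it down, and then the smaller
Garside element acts. -/
theorem garside_mul (h : IsSingularBraidFamily m s x) {t : ℕ} (ht : t ≤ m) {i : ℕ} (hi : i < t) :
    garside s t * x i = x (t - 1 - i) * garside s t := by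
  induction t generalizing i with
  | zero => omega
  | succ t ih =>
    rcases Nat.lt_or_ge i t with hit | hit
    · rw [garside, mul_assoc, ih (by omega) hit, ← mul_assoc,
        h.ascProd_mul ht (i := t - 1 - i) (by omega), mul_assoc,
        show t - 1 - i + 1 = t + 1 - 1 - i by omega]
    · obtain rfl : i = t := by omega
      rcases i with _ | i
      · simpa [garside, ascProd] using (h.xcomm 0 0 (by omega) (by omega) (by omega)).symm
      · rw [h.garside_succ (by omega), mul_assoc, h.descProd_mul ht (by omega), ← mul_assoc,
          ih (by omega) (by omega), mul_assoc, show i + 1 - 1 - i = i + 1 + 1 - 1 - (i + 1) by omega]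

theorem commute_garside_sq (h : IsSingularBraidFamily m s x) {i : ℕ} (hi : i < m) :
    Commute (garside s m ^ 2) (x i) := by
  change garside s m ^ 2 * x i = x i * garside s m ^ 2
  rw [pow_two, mul_assoc, h.garside_mul le_rfl hi, ← mul_assoc,
    h.garside_mul le_rfl (by omega), mul_assoc, show m - 1 - (m - 1 - i) = i by omega]

theorem ascProd_mul_garside (h : IsSingularBraidFamily m s s) {t : ℕ} (ht : t < m) :
    ascProd s (t + 1) * garside s t = garside (fun i => s (i + 1)) t * ascProd s (t + 1) := by
  have key : ∀ l ≤ t, ascProd s (t + 1) * ascProd s l =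
      ascProd (fun i => s (i + 1)) l * ascProd s (t + 1) := by
    intro l hl
    induction l with
    | zero => simp [ascProd]
    | succ l ih =>
      rw [ascProd.eq_2 s l, ascProd.eq_2 _ l, ← mul_assoc, ih (by omega), mul_assoc,
        h.ascProd_mul (by omega) (by omega), mul_assoc]
  have : ∀ k ≤ t, ascProd s (t + 1) * garside s k =
      garside (fun i => s (i + 1)) k * ascProd s (t + 1) := by
    intro k hk
    induction k with
    | zero => simp [garside]
    | succ k ih =>
      rw [garside, garside, ← mul_assoc, key (k + 1) hk, mul_assoc, ih (by omega),
        mul_assoc]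
  exact this t le_rfl

theorem garside_mul_descProd (h : IsSingularBraidFamily m s s) {t : ℕ} (ht : t < m) :
    garside s t * descProd s (t + 1) = descProd s (t + 1) * garside (fun i => s (i + 1)) t := by
  have key : ∀ l ≤ t, ascProd s l * descProd s (t + 1) =
      descProd s (t + 1) * ascProd (fun i => s (i + 1)) l := by
    intro l hl
    induction l with
    | zero => simp [ascProd]
    | succ l ih =>
      rw [ascProd, ascProd, mul_assoc, ← h.descProd_mul (by omega) (by omega), ← mul_assoc,
        ih (by omega), mul_assoc]
  have : ∀ k ≤ t, garside s k * descProd s (t + 1) =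
      descProd s (t + 1) * garside (fun i => s (i + 1)) k := by
    intro k hk
    induction k with
    | zero => simp [garside]
    | succ k ih =>
      rw [garside, garside, mul_assoc, ih (by omega), ← mul_assoc, key (k + 1) hk, mul_assoc]
  exact this t le_rfl

/-- The square of the Garside element through the Garside element of the shifted family. -/
theorem garside_sq (h : IsSingularBraidFamily m s s) {t : ℕ} (ht : t < m) :
    garside s (t + 1) ^ 2 = garside (fun i => s (i + 1)) t * ascProd s (t + 1) *
      descProd s (t + 1) * garside (fun i => s (i + 1)) t := by
  rw [mul_assoc _ (descProd _ _), ← h.garside_mul_descProd ht, ← h.ascProd_mul_garside ht, pow_two,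
    ← h.garside_succ ht]
  rfl

end IsSingularBraidFamily

end

/-! ### Generators and universal property of the braid group -/

namespace BraidGroup

/-- The generators of the braid group indexed by natural numbers; trivial out of range. -/
def gen (n i : ℕ) : BraidGroup n := if h : i < n - 1 then sigma ⟨i, h⟩ else 1

theorem gen_val {n : ℕ} (i : Fin (n - 1)) : gen n i = sigma i := by simp [gen]

theorem gen_comm {n i j : ℕ} (h : i + 1 < j) (hj : j < n - 1) :
    gen n i * gen n j = gen n j * gen n i := by
  rw [gen, gen, dif_pos hj, dif_pos (by omega : i < n - 1)]
  have := PresentedGroup.one_of_mem (rels := {r | BraidRelator n r})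
    (BraidRelator.comm ⟨i, by omega⟩ ⟨j, hj⟩ (by
      rw [abs_sub_comm, lt_abs]; left; simp only; omega))
  rw [map_mul, map_inv, mul_inv_eq_one] at this
  exact this

theorem gen_braid {n i : ℕ} (h : i + 1 < n - 1) :
    gen n i * gen n (i + 1) * gen n i = gen n (i + 1) * gen n i * gen n (i + 1) := by
  rw [gen, gen, dif_pos h, dif_pos (by omega : i < n - 1)]
  have := PresentedGroup.one_of_mem (rels := {r | BraidRelator n r})
    (BraidRelator.braid ⟨i, by omega⟩ ⟨i + 1, h⟩ rfl)
  rw [map_mul, map_inv, mul_inv_eq_one] at this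
  exact this

theorem isSingularBraidFamily_gen (n : ℕ) :
    IsSingularBraidFamily (n - 1) (gen n) (gen n) where
  comm _ _ h hj := gen_comm h hj
  xcomm i j h hi hj := by
    rcases h with h | h | rfl
    · exact gen_comm h hj
    · exact (gen_comm h hi).symm
    · rfl
  slide_right i h := by
    exact gen_braid h
  slide_left i h := by
    exact (gen_braid h).symm

theorem prefixProd_eq {n t : ℕ} (ht : t ≤ n - 1) : prefixProd n t = ascProd (gen n) t := by
  induction t with
  | zero => simp [prefixProd, ascProd]
  | succ t ih =>
    have hlt : t < (List.finRange (n - 1)).length := by simp; omega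
    rw [prefixProd, List.take_succ_eq_append_getElem hlt, List.map_append, List.prod_append,
      ascProd, ← ih (by omega)]
    simp [prefixProd, gen, show t < n - 1 by omega]

theorem fundamental_eq (n : ℕ) : fundamental n = garside (gen n) (n - 1) := by
  have : ∀ t ≤ n - 1, ((List.range t).reverse.map (fun t => prefixProd n (t + 1))).prod =
      garside (gen n) t := by
    intro t ht
    induction t with
    | zero => simp [garside]
    | succ t ih =>
      rw [List.range_succ, List.reverse_append, List.map_append, List.prod_append, ih (by omega)]
      simp [garside, prefixProd_eq ht]
  exact this _ le_rfl

/-- The homomorphism from the braid group given by a family satisfying the braid relations. -/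
def lift {G : Type*} [Group G] {n : ℕ} (s : ℕ → G)
    (hc : ∀ i j, i + 1 < j → j < n - 1 → s i * s j = s j * s i)
    (hb : ∀ i, i + 1 < n - 1 → s i * s (i + 1) * s i = s (i + 1) * s i * s (i + 1)) :
    BraidGroup n →* G :=
  PresentedGroup.toGroup (f := fun i : Fin (n - 1) => s i) (by
    rintro r (⟨i, j, h⟩ | ⟨i, j, h⟩)
    · simp only [map_mul, map_inv, FreeGroup.lift_apply_of, mul_inv_eq_one]
      rcases lt_abs.1 h with h | h
      · exact (hc j i (by omega) i.2).symm
      · exact hc i j (by omega) j.2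
    · simp only [map_mul, map_inv, FreeGroup.lift_apply_of, mul_inv_eq_one]
      rw [← h]
      exact hb i (by omega))

theorem lift_gen {G : Type*} [Group G] {n : ℕ} {s : ℕ → G}
    {hc : ∀ i j, i + 1 < j → j < n - 1 → s i * s j = s j * s i}
    {hb : ∀ i, i + 1 < n - 1 → s i * s (i + 1) * s i = s (i + 1) * s i * s (i + 1)}
    {i : ℕ} (hi : i < n - 1) : lift s hc hb (gen n i) = s i := by
  rw [gen, dif_pos hi]
  exact PresentedGroup.toGroup.of _

theorem closure_gen (n : ℕ) : Subgroup.closure (gen n '' Set.Iio (n - 1)) = ⊤ := by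
  rw [← PresentedGroup.closure_range_of]
  congr 1
  ext g
  constructor
  · rintro ⟨i, hi, rfl⟩
    exact ⟨⟨i, hi⟩, (gen_val (n := n) ⟨i, hi⟩).symm⟩
  · rintro ⟨i, rfl⟩
    exact ⟨i, i.2, gen_val i⟩

@[elab_as_elim]
theorem gen_induction {n : ℕ} {p : BraidGroup n → Prop} (g : BraidGroup n)
    (gen : ∀ i < n - 1, p (gen n i)) (one : p 1) (mul : ∀ a b, p a → p b → p (a * b))
    (inv : ∀ a, p a → p a⁻¹) : p g := by
  have hg : g ∈ Subgroup.closure (BraidGroup.gen n '' Set.Iio (n - 1)) := by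
    rw [closure_gen]; trivial
  induction hg using Subgroup.closure_induction with
  | mem x hx => obtain ⟨i, hi, rfl⟩ := hx; exact gen i hi
  | one => exact one
  | mul a b _ _ ha hb => exact mul a b ha hb
  | inv a _ ha => exact inv a ha

theorem mem_center_of_gen {n : ℕ} {z : BraidGroup n}
    (h : ∀ i < n - 1, Commute z (gen n i)) : z ∈ Subgroup.center (BraidGroup n) := by
  rw [Subgroup.mem_center_iff]
  intro g
  induction g using gen_induction with
  | gen i hi => exact (h i hi).symm.eq
  | one => simp
  | mul a b ha hb => exact (Commute.mul_left (a := a) (b := b) ha hb)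
  | inv a ha => exact Commute.inv_left (a := a) ha

theorem fundamental_sq_mem_center (n : ℕ) :
    fundamental n ^ 2 ∈ Subgroup.center (BraidGroup n) := by
  rw [fundamental_eq]
  exact mem_center_of_gen fun i hi => (isSingularBraidFamily_gen n).commute_garside_sq hi

end BraidGroup

/-! ### Centralizers and conjugacy of free generators -/

namespace FreeGroup

/-- If the first letter of `f` were not `a` or its inverse, prefixing `a` would give a reduced word.
By commutation and a comparison of lengths, appending `a` would also give a reduced word, and the
two words would coincide, so their first letters agree. -/
theorem head_of_commute_of {α : Type*} [DecidableEq α] {f : FreeGroup α} {a : α}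
    (h : Commute f (of a)) {c : α × Bool} {l : List (α × Bool)} (hf : f.toWord = c :: l) :
    c.1 = a := by
  by_contra hc
  have hred : (of a * f).toWord = (a, true) :: c :: l := by
    have : IsReduced ((a, true) :: c :: l) := by
      have := isReduced_toWord (x := f)
      rw [hf] at this
      exact isReduced_cons_cons.2 ⟨fun h => absurd h.symm hc, this⟩
    rw [toWord_mul, toWord_of, hf]
    exact this.reduce_eq
  have h2 := congrArg toWord h.eq
  have hlen : (f.toWord ++ [(a, true)]).length = (reduce (f.toWord ++ [(a, true)])).length := by
    rw [← toWord_of, ← toWord_mul, h2, hred, hf]; simp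
  have hself : reduce (f.toWord ++ [(a, true)]) = f.toWord ++ [(a, true)] :=
    (reduce.red (L := f.toWord ++ [(a, true)])).sublist.eq_of_length hlen.symm
  rw [← toWord_of, ← toWord_mul, h2, hred, hf, toWord_of] at hself
  simp only [List.cons_append, List.cons.injEq] at hself
  exact hc (by rw [← hself.1])

theorem eq_one_of_commute_of {α : Type*} {f : FreeGroup α} {a b : α} (hab : a ≠ b)
    (ha : Commute f (of a)) (hb : Commute f (of b)) : f = 1 := by
  classical
  rcases hf : f.toWord with _ | ⟨c, l⟩
  · exact toWord_eq_nil_iff.1 hf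
  · exact absurd ((head_of_commute_of ha hf).symm.trans (head_of_commute_of hb hf)) hab

theorem not_commute_of_pow {α : Type*} {a b : α} (hab : a ≠ b) {N : ℕ} (hN : N ≠ 0) :
    ¬ Commute (of a ^ N) (of b) := by
  classical
  intro h
  have h1 := eq_one_of_commute_of hab ((Commute.refl (of a)).pow_left N) h
  have h2 := norm_of_pow a N
  rw [h1, norm_one] at h2
  exact hN h2.symm

theorem of_eq_of_isConj {α : Type*} {a b : α} (h : IsConj (of a) (of b)) : a = b := by
  classical
  by_contra hab
  obtain ⟨c, hc⟩ := isConj_iff.1 h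
  -- The exponent sum of `a` is invariant under conjugation and separates `a` from `b`.
  have := congrArg (lift fun i => Multiplicative.ofAdd (if i = a then (1 : ℤ) else 0)) hc
  simp [Ne.symm hab] at this

end FreeGroup

/-! ### Artin's representation and the permutation of a braid -/

/-- The images of the free generators under Artin's automorphism. -/
def artinImage (i q : ℕ) : FreeGroup ℕ :=
  if q = i then .of (i + 1)
  else if q = i + 1 then (.of (i + 1))⁻¹ * .of i * .of (i + 1) else .of q

/-- The images of the free generators under the inverse of Artin's automorphism. -/
def artinInvImage (i q : ℕ) : FreeGroup ℕ :=
  if q = i then .of i * .of (i + 1) * (.of i)⁻¹ else if q = i + 1 then .of i else .of q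

/-- Artin's automorphism of the free group attached to the `i`-th generator. -/
def artinAut (i : ℕ) : MulAut (FreeGroup ℕ) :=
  MonoidHom.toMulEquiv (FreeGroup.lift (artinImage i)) (FreeGroup.lift (artinInvImage i))
    (by
      ext q
      by_cases h : q = i
      · subst h; simp [artinImage, artinInvImage]
      · by_cases h' : q = i + 1
        · subst h'; simp [artinImage, artinInvImage]; group
        · simp [artinImage, artinInvImage, h, h'])
    (by
      ext q
      by_cases h : q = i
      · subst h; simp [artinImage, artinInvImage]; group
      · by_cases h' : q = i + 1
        · subst h'; simp [artinImage, artinInvImage]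
        · simp [artinImage, artinInvImage, h, h'])

theorem artinAut_of (i q : ℕ) : artinAut i (.of q) = artinImage i q := by
  simp [artinAut]

theorem artinAut_self (i : ℕ) : artinAut i (.of i) = .of (i + 1) := by
  simp [artinAut_of, artinImage]

theorem artinAut_succ (i : ℕ) :
    artinAut i (.of (i + 1)) = (.of (i + 1))⁻¹ * .of i * .of (i + 1) := by
  simp [artinAut_of, artinImage]

theorem artinAut_of_ne {i q : ℕ} (h : q ≠ i) (h' : q ≠ i + 1) :
    artinAut i (.of q) = .of q := by
  simp [artinAut_of, artinImage, h, h']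

theorem MulAut.ext_freeGroup {α : Type*} {f g : MulAut (FreeGroup α)}
    (h : ∀ a, f (.of a) = g (.of a)) : f = g := by
  apply MulEquiv.toMonoidHom_injective
  ext a
  exact h a

theorem artinAut_comm {i j : ℕ} (h : i + 1 < j) :
    artinAut i * artinAut j = artinAut j * artinAut i := by
  apply MulAut.ext_freeGroup
  intro q
  simp only [MulAut.mul_apply]
  rcases eq_or_ne q i with rfl | h1
  · rw [artinAut_of_ne (i := j) (by omega) (by omega), artinAut_self,
      artinAut_of_ne (by omega) (by omega)]
  rcases eq_or_ne q (i + 1) with rfl | h2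
  · rw [artinAut_of_ne (i := j) (by omega) (by omega), artinAut_succ]
    simp only [map_mul, map_inv]
    rw [artinAut_of_ne (i := j) (by omega) (by omega),
      artinAut_of_ne (i := j) (by omega) (by omega)]
  rcases eq_or_ne q j with rfl | h3
  · rw [artinAut_of_ne (i := i) (by omega) (by omega), artinAut_self,
      artinAut_of_ne (by omega) (by omega)]
  rcases eq_or_ne q (j + 1) with rfl | h4
  · rw [artinAut_of_ne (i := i) (by omega) (by omega), artinAut_succ]
    simp only [map_mul, map_inv]
    rw [artinAut_of_ne (i := i) (by omega) (by omega),
      artinAut_of_ne (i := i) (by omega) (by omega)]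
  · rw [artinAut_of_ne (i := i) h1 h2, artinAut_of_ne (i := j) h3 h4, artinAut_of_ne h1 h2]

theorem artinAut_braid (i : ℕ) :
    artinAut i * artinAut (i + 1) * artinAut i =
      artinAut (i + 1) * artinAut i * artinAut (i + 1) := by
  apply MulAut.ext_freeGroup
  intro q
  have e1 := artinAut_self i
  have e2 := artinAut_succ i
  have e3 : artinAut i (.of (i + 2)) = .of (i + 2) := artinAut_of_ne (by omega) (by omega)
  have f1 : artinAut (i + 1) (.of i) = .of i := artinAut_of_ne (by omega) (by omega)
  have f2 := artinAut_self (i + 1)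
  have f3 := artinAut_succ (i + 1)
  simp only [add_assoc, Nat.reduceAdd] at f2 f3
  simp only [MulAut.mul_apply]
  rcases eq_or_ne q i with rfl | h1
  · simp only [e1, e3, f1, f2]
  rcases eq_or_ne q (i + 1) with rfl | h2
  · simp only [e1, e2, e3, f1, f2, f3, map_mul, map_inv]
  rcases eq_or_ne q (i + 2) with rfl | h3
  · simp only [e2, e3, f1, f2, f3, map_mul, map_inv]
    group
  · rw [artinAut_of_ne (i := i) h1 h2, artinAut_of_ne (i := i + 1) h2 h3,
      artinAut_of_ne (i := i) h1 h2, artinAut_of_ne (i := i + 1) h2 h3]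

/-- The transposition of `i` and `i + 1`. -/
abbrev adjSwap (i : ℕ) : Equiv.Perm ℕ := Equiv.swap i (i + 1)

theorem adjSwap_of_ne {i p : ℕ} (h : p ≠ i) (h' : p ≠ i + 1) : adjSwap i p = p :=
  Equiv.swap_apply_of_ne_of_ne h h'

theorem adjSwap_comm {i j : ℕ} (h : i + 1 < j) :
    adjSwap i * adjSwap j = adjSwap j * adjSwap i := by
  ext p
  simp only [Equiv.Perm.mul_apply, Equiv.swap_apply_def]
  grind

theorem adjSwap_braid (i : ℕ) :
    adjSwap i * adjSwap (i + 1) * adjSwap i = adjSwap (i + 1) * adjSwap i * adjSwap (i + 1) := by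
  ext p
  simp only [Equiv.Perm.mul_apply, Equiv.swap_apply_def]
  grind

namespace BraidGroup

/-- Artin's representation of the braid group on a free group. -/
def artin (n : ℕ) : BraidGroup n →* MulAut (FreeGroup ℕ) :=
  lift artinAut (fun _ _ h _ => artinAut_comm h) (fun i _ => artinAut_braid i)

theorem artin_gen {n i : ℕ} (hi : i < n - 1) : artin n (gen n i) = artinAut i := lift_gen hi

/-- The permutation of a braid. -/
def perm (n : ℕ) : BraidGroup n →* Equiv.Perm ℕ :=
  lift adjSwap (fun _ _ h _ => adjSwap_comm h) (fun i _ => adjSwap_braid i)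

theorem perm_gen {n i : ℕ} (hi : i < n - 1) : perm n (gen n i) = adjSwap i := lift_gen hi

theorem isConj_artinAut (i q : ℕ) : IsConj (artinAut i (.of q)) (.of (adjSwap i q)) := by
  rcases eq_or_ne q i with rfl | h
  · rw [artinAut_self, Equiv.swap_apply_left]
  rcases eq_or_ne q (i + 1) with rfl | h'
  · rw [artinAut_succ, Equiv.swap_apply_right]
    exact isConj_iff.2 ⟨.of (i + 1), by group⟩
  · rw [artinAut_of_ne h h', adjSwap_of_ne h h']

theorem isConj_artin {n : ℕ} (g : BraidGroup n) (q : ℕ) :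
    IsConj (artin n g (.of q)) (.of (perm n g q)) := by
  induction g using gen_induction generalizing q with
  | gen i hi => rw [artin_gen hi, perm_gen hi]; exact isConj_artinAut i q
  | one => rw [map_one, map_one]; exact IsConj.refl _
  | mul a b ha hb =>
    rw [map_mul, map_mul, MulAut.mul_apply, Equiv.Perm.mul_apply]
    exact ((artin n a).toMonoidHom.map_isConj (hb q)).trans (ha _)
  | inv a ha =>
    have := ((artin n a)⁻¹).toMonoidHom.map_isConj (ha ((perm n a)⁻¹ q))
    simpa using this.symm

end BraidGroup

/-! ### The representation induced from the stabilizer of the first position -/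

namespace BraidGroup

/-- The semidirect product of a free group with a braid group on one string less. -/
abbrev PointedBraid (n : ℕ) : Type :=
  SemidirectProduct (FreeGroup ℕ) (BraidGroup (n - 1)) (artin (n - 1))

open SemidirectProduct

theorem inr_mul_inl {n : ℕ} (g : BraidGroup (n - 1)) (f : FreeGroup ℕ) :
    (inr g * inl f : PointedBraid n) = inl (artin (n - 1) g f) * inr g := by
  rw [inl_aut]; simp

theorem inr_gen_mul_inl_of_ne {n k q : ℕ} (hk : k < n - 1 - 1) (h : q ≠ k) (h' : q ≠ k + 1) :
    (inr (gen (n - 1) k) * inl (.of q) : PointedBraid n) =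
      inl (.of q) * inr (gen (n - 1) k) := by
  rw [inr_mul_inl, artin_gen hk, artinAut_of_ne h h']

theorem inr_gen_mul_inl_self {n k : ℕ} (hk : k < n - 1 - 1) :
    (inr (gen (n - 1) k) * inl (.of k) : PointedBraid n) =
      inl (.of (k + 1)) * inr (gen (n - 1) k) := by
  rw [inr_mul_inl, artin_gen hk, artinAut_self]

theorem inr_gen_mul_inl_mul_inl {n k : ℕ} (hk : k < n - 1 - 1) :
    (inr (gen (n - 1) k) * (inl (.of k) * inl (.of (k + 1))) : PointedBraid n) =
      inl (.of k) * inl (.of (k + 1)) * inr (gen (n - 1) k) := by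
  rw [← map_mul, inr_mul_inl, artin_gen hk, map_mul (artinAut k), artinAut_self, artinAut_succ]
  congr 2
  group

/-- The cocycle describing the action of the generator `i` on the position `p`. -/
def cocycle (n i p : ℕ) : PointedBraid n :=
  -- Positions above `n - 1` carry no string. In the next case the index drops by one because
  -- generator `k` of the smaller group is generator `k + 1` of the large one.
  if n - 1 < p then 1
  else if p < i then inr (gen (n - 1) (i - 1))
  else if p = i then 1
  else if p = i + 1 then inl (.of i)
  else inr (gen (n - 1) i)

theorem cocycle_lt {n i p : ℕ} (hi : i < n - 1) (h : p < i) :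
    cocycle n i p = inr (gen (n - 1) (i - 1)) := by
  rw [cocycle, if_neg (by omega), if_pos h]

theorem cocycle_self {n i : ℕ} : cocycle n i i = 1 := by
  simp [cocycle]

theorem cocycle_succ {n i : ℕ} (hi : i < n - 1) : cocycle n i (i + 1) = inl (.of i) := by
  rw [cocycle, if_neg (by omega), if_neg (by omega), if_neg (by omega), if_pos rfl]

theorem cocycle_gt {n i p : ℕ} (hp : p ≤ n - 1) (h : i + 1 < p) :
    cocycle n i p = inr (gen (n - 1) i) := by
  rw [cocycle, if_neg (by omega), if_neg (by omega), if_neg (by omega), if_neg (by omega)]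

theorem cocycle_out {n i p : ℕ} (hp : n - 1 < p) : cocycle n i p = 1 := by
  rw [cocycle, if_pos hp]

theorem adjSwap_left (i : ℕ) : adjSwap i i = i + 1 := Equiv.swap_apply_left _ _

theorem adjSwap_right (i : ℕ) : adjSwap i (i + 1) = i := Equiv.swap_apply_right _ _

theorem cocycle_comm {n i j : ℕ} (h : i + 1 < j) (hj : j < n - 1) (p : ℕ) :
    cocycle n i (adjSwap j p) * cocycle n j p = cocycle n j (adjSwap i p) * cocycle n i p := by
  have hi : i < n - 1 := by omega
  rcases Nat.lt_or_ge (n - 1) p with hp | hp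
  · rw [adjSwap_of_ne (by omega) (by omega), adjSwap_of_ne (by omega) (by omega),
      cocycle_out hp, cocycle_out hp]
  rcases Nat.lt_or_ge p i with h1 | h1
  · rw [adjSwap_of_ne (by omega) (by omega), adjSwap_of_ne (by omega) (by omega),
      cocycle_lt hi h1, cocycle_lt hj (by omega), ← map_mul, ← map_mul,
      gen_comm (by omega) (by omega)]
  rcases eq_or_ne p i with rfl | h2
  · rw [adjSwap_of_ne (by omega) (by omega), adjSwap_left, cocycle_self, cocycle_lt hj (by omega),
      cocycle_lt hj (by omega), one_mul, mul_one]
  rcases eq_or_ne p (i + 1) with rfl | h3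
  · rw [adjSwap_of_ne (by omega) (by omega), adjSwap_right, cocycle_succ hi,
      cocycle_lt hj (by omega), cocycle_lt hj (by omega),
      inr_gen_mul_inl_of_ne (by omega) (by omega) (by omega)]
  rcases Nat.lt_or_ge p j with h4 | h4
  · rw [adjSwap_of_ne (by omega) (by omega), adjSwap_of_ne (by omega) (by omega),
      cocycle_gt hp (by omega), cocycle_lt hj (by omega), ← map_mul, ← map_mul,
      gen_comm (by omega) (by omega)]
  rcases eq_or_ne p j with rfl | h5
  · rw [adjSwap_of_ne (i := i) (by omega) (by omega), adjSwap_left, cocycle_self,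
      cocycle_gt (by omega) (by omega), cocycle_gt hp (by omega), one_mul, mul_one]
  rcases eq_or_ne p (j + 1) with rfl | h6
  · rw [adjSwap_of_ne (i := i) (by omega) (by omega), adjSwap_right, cocycle_succ hj,
      cocycle_gt (by omega) (by omega), cocycle_gt hp (by omega),
      inr_gen_mul_inl_of_ne (by omega) (by omega) (by omega)]
  · rw [adjSwap_of_ne (by omega) (by omega), adjSwap_of_ne (by omega) (by omega),
      cocycle_gt hp (by omega), cocycle_gt hp (by omega), ← map_mul, ← map_mul,
      gen_comm (by omega) (by omega)]

/-- Away from the three strings involved this is a braid relation in the smaller group. At `i + 1`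
and `i + 2` it says that Artin's automorphism takes the `i`-th free generator to the next one and
fixes their product. -/
theorem cocycle_braid {n i : ℕ} (hj : i + 1 < n - 1) (p : ℕ) :
    cocycle n i (adjSwap (i + 1) (adjSwap i p)) * (cocycle n (i + 1) (adjSwap i p) *
        cocycle n i p) =
      cocycle n (i + 1) (adjSwap i (adjSwap (i + 1) p)) * (cocycle n i (adjSwap (i + 1) p) *
        cocycle n (i + 1) p) := by
  have hi : i < n - 1 := by omega
  rcases Nat.lt_or_ge (n - 1) p with hp | hp
  · have e1 : adjSwap i p = p := adjSwap_of_ne (by omega) (by omega)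
    have e2 : adjSwap (i + 1) p = p := adjSwap_of_ne (by omega) (by omega)
    rw [e1, e2, e1, cocycle_out hp, cocycle_out hp]
  rcases Nat.lt_or_ge p i with h1 | h1
  · have e1 : adjSwap i p = p := adjSwap_of_ne (by omega) (by omega)
    have e2 : adjSwap (i + 1) p = p := adjSwap_of_ne (by omega) (by omega)
    obtain ⟨k, rfl⟩ : ∃ k, i = k + 1 := ⟨i - 1, by omega⟩
    rw [e1, e2, e1, cocycle_lt hi h1, cocycle_lt hj (by omega)]
    simp only [← map_mul, ← mul_assoc]
    exact congrArg _ (gen_braid (by omega))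
  rcases eq_or_ne p i with rfl | h2
  · have e2 : adjSwap (p + 1) p = p := adjSwap_of_ne (by omega) (by omega)
    rw [e2, adjSwap_left, adjSwap_left, cocycle_self, cocycle_self,
      cocycle_gt (by omega) (by omega), cocycle_lt hj (by omega)]
    simp
  rcases eq_or_ne p (i + 1) with rfl | h3
  · have e2 : adjSwap (i + 1) i = i := adjSwap_of_ne (by omega) (by omega)
    have e3 : adjSwap i (i + 1 + 1) = i + 1 + 1 := adjSwap_of_ne (by omega) (by omega)
    rw [adjSwap_left, adjSwap_right, e2, e3, cocycle_self, cocycle_self, cocycle_succ hi,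
      cocycle_lt hj (by omega), cocycle_succ hj, cocycle_gt (by omega) (by omega)]
    simpa using inr_gen_mul_inl_self (n := n) (k := i) (by omega)
  rcases eq_or_ne p (i + 1 + 1) with rfl | h4
  · have e3 : adjSwap i (i + 1 + 1) = i + 1 + 1 := adjSwap_of_ne (by omega) (by omega)
    rw [e3, adjSwap_right, adjSwap_right, cocycle_succ hi, cocycle_succ hj,
      cocycle_lt hj (by omega), cocycle_gt (by omega) (by omega)]
    simpa [mul_assoc] using (inr_gen_mul_inl_mul_inl (n := n) (k := i) (by omega)).symm
  · have e1 : adjSwap i p = p := adjSwap_of_ne (by omega) (by omega)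
    have e2 : adjSwap (i + 1) p = p := adjSwap_of_ne (by omega) (by omega)
    rw [e1, e2, e1, cocycle_gt hp (by omega), cocycle_gt hp (by omega)]
    simp only [← map_mul, ← mul_assoc]
    exact congrArg _ (gen_braid (by omega))

/-- The action of a generator on positions decorated with elements of `PointedBraid n`. -/
def stepPerm (n i : ℕ) : Equiv.Perm (ℕ × PointedBraid n) :=
  Equiv.prodShear (adjSwap i) fun p => Equiv.mulLeft (cocycle n i p)

theorem stepPerm_apply (n i p : ℕ) (h : PointedBraid n) :
    stepPerm n i (p, h) = (adjSwap i p, cocycle n i p * h) := rfl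

/-- The representation of the braid group induced from the stabilizer of the first position. -/
def induced (n : ℕ) : BraidGroup n →* Equiv.Perm (ℕ × PointedBraid n) :=
  lift (stepPerm n)
    (fun i j h hj => by
      ext1 ⟨p, h'⟩
      simp only [Equiv.Perm.mul_apply, stepPerm_apply, ← mul_assoc, cocycle_comm h hj]
      rw [← Equiv.Perm.mul_apply, adjSwap_comm h, Equiv.Perm.mul_apply])
    (fun i h => by
      ext1 ⟨p, h'⟩
      have h1 := cocycle_braid h p
      have h2 := DFunLike.congr_fun (adjSwap_braid i) p
      simp only [Equiv.Perm.mul_apply] at h2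
      simp only [Equiv.Perm.mul_apply, stepPerm_apply, h2, ← mul_assoc] at h1 ⊢
      rw [h1])

theorem induced_gen {n i : ℕ} (hi : i < n - 1) (p : ℕ) (h : PointedBraid n) :
    induced n (gen n i) (p, h) = (adjSwap i p, cocycle n i p * h) := by
  rw [induced, lift_gen hi, stepPerm_apply]

/-- The action commutes with right multiplication on the decoration, so it is determined by its
values at the decoration `1`. -/
theorem induced_apply {n : ℕ} (g : BraidGroup n) (p : ℕ) (h : PointedBraid n) :
    induced n g (p, h) = (perm n g p, (induced n g (p, 1)).2 * h) := by
  induction g using gen_induction generalizing p h with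
  | gen i hi => rw [induced_gen hi, induced_gen hi, perm_gen hi, mul_one]
  | one => simp
  | mul a b ha hb =>
    simp only [map_mul, Equiv.Perm.mul_apply]
    rw [hb p h, hb p 1, ha _ (_ * h), ha _ (_ * 1)]
    simp [mul_assoc]
  | inv a ha =>
    obtain ⟨q, rfl⟩ : ∃ q, p = perm n a q := ⟨(perm n a)⁻¹ p, by simp⟩
    have key (h) : induced n a⁻¹ (perm n a q, h) = (q, ((induced n a (q, 1)).2)⁻¹ * h) := by
      rw [map_inv, Equiv.Perm.inv_eq_iff_eq, ha]
      simp
    rw [key, key]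
    simp

/-- The element of `PointedBraid n` attached to a braid fixing the first position. -/
def toPointed {n : ℕ} (g : BraidGroup n) : PointedBraid n := (induced n g (0, 1)).2

theorem induced_zero {n : ℕ} {g : BraidGroup n} (hg : perm n g 0 = 0) (h : PointedBraid n) :
    induced n g (0, h) = (0, toPointed g * h) := by
  rw [induced_apply, hg]; rfl

theorem toPointed_eq {n : ℕ} {g : BraidGroup n} {h : PointedBraid n} {p : ℕ}
    (hg : induced n g (0, 1) = (p, h)) : toPointed g = h := by
  rw [toPointed, hg]

theorem toPointed_mul {n : ℕ} (a : BraidGroup n) {b : BraidGroup n} (hb : perm n b 0 = 0) :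
    toPointed (a * b) = toPointed a * toPointed b := by
  rw [toPointed, map_mul, Equiv.Perm.mul_apply, induced_zero hb, mul_one, induced_apply]
  rfl

end BraidGroup

/-! ### Meridians and the reconstruction of a braid from its pointed form -/

namespace BraidGroup

open SemidirectProduct

/-- The inclusion of braid groups adding a trivial first string. -/
def shift (n : ℕ) : BraidGroup (n - 1) →* BraidGroup n :=
  lift (fun i => gen n (i + 1)) (fun _ _ h _ => gen_comm (by omega) (by omega))
    (fun _ _ => gen_braid (by omega))

theorem shift_gen {n i : ℕ} (hi : i < n - 1 - 1) : shift n (gen (n - 1) i) = gen n (i + 1) :=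
  lift_gen hi

theorem gen_out {n i : ℕ} (hi : n - 1 ≤ i) : gen n i = 1 := by
  rw [gen, dif_neg (by omega)]

/-- The pure braid in which the first string winds around the string at position `q + 1`. -/
def meridian (n q : ℕ) : BraidGroup n :=
  (descProd (gen n) q)⁻¹ * gen n q ^ 2 * descProd (gen n) q

theorem gen_commute_descProd {n k q : ℕ} (h : q < k) (hk : k < n - 1) :
    Commute (gen n k) (descProd (gen n) q) :=
  commute_descProd q fun _ _ => (gen_comm (by omega) hk).symm

theorem descProd_mul_gen {n q k : ℕ} (h : k + 1 < q) (hq : q ≤ n - 1) :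
    descProd (gen n) q * gen n (k + 1) = gen n k * descProd (gen n) q :=
  (isSingularBraidFamily_gen n).descProd_mul hq h

theorem gen_conj_meridian_of_ne {n k q : ℕ} (hk : k < n - 1 - 1) (h : q ≠ k) (h' : q ≠ k + 1) :
    Commute (gen n (k + 1)) (meridian n q) := by
  rcases Nat.lt_or_ge q k with h1 | h1
  · have c1 : Commute (gen n (k + 1)) (descProd (gen n) q) :=
      gen_commute_descProd (by omega) (by omega)
    have c2 : Commute (gen n (k + 1)) (gen n q) := (gen_comm (by omega) (by omega)).symm
    exact (c1.inv_right.mul_right (c2.pow_right 2)).mul_right c1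
  · rcases Nat.lt_or_ge q (n - 1) with h2 | h2
    · have c : Commute (gen n k) (gen n q ^ 2) :=
        Commute.pow_right (gen_comm (by omega) (by omega)) 2
      have e := descProd_mul_gen (n := n) (q := q) (k := k) (by omega) (by omega)
      have e' : gen n (k + 1) = (descProd (gen n) q)⁻¹ * gen n k * descProd (gen n) q := by
        rw [mul_assoc, ← e]; group
      change gen n (k + 1) * meridian n q = meridian n q * gen n (k + 1)
      calc _ = (descProd (gen n) q)⁻¹ * (gen n k * gen n q ^ 2) * descProd (gen n) q := by
            rw [e', meridian]; group
        _ = _ := by rw [c.eq, e', meridian]; group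
    -- Out of range the meridian is `1`, so the surplus free generators are harmless.
    · rw [meridian, gen_out h2]; simp

theorem braid_sq_identity {G : Type*} [Group G] {a b : G} (h : a * b * a = b * a * b) :
    b * a ^ 2 * b⁻¹ = a⁻¹ * b ^ 2 * a := by
  have h1 : a * b * a * b⁻¹ = b * a := by rw [h]; group
  calc b * a ^ 2 * b⁻¹ = a⁻¹ * (a * b * a) * (a * b⁻¹) := by rw [pow_two]; group
    _ = a⁻¹ * (b * a * b) * (a * b⁻¹) := by rw [h]
    _ = a⁻¹ * b * (a * b * a * b⁻¹) := by group
    _ = a⁻¹ * b ^ 2 * a := by rw [h1, pow_two]; group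

theorem gen_conj_meridian_self {n k : ℕ} (hk : k < n - 1 - 1) :
    gen n (k + 1) * meridian n k * (gen n (k + 1))⁻¹ = meridian n (k + 1) := by
  have c : Commute (gen n (k + 1)) (descProd (gen n) k) :=
    gen_commute_descProd (by omega) (by omega)
  have e := braid_sq_identity (gen_braid (n := n) (i := k) (by omega))
  calc _ = gen n (k + 1) * (descProd (gen n) k)⁻¹ * gen n k ^ 2 *
        (descProd (gen n) k * (gen n (k + 1))⁻¹) := by rw [meridian]; group
    _ = (descProd (gen n) k)⁻¹ * (gen n (k + 1) * gen n k ^ 2 * (gen n (k + 1))⁻¹) *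
        descProd (gen n) k := by rw [c.inv_right.eq, ← c.inv_left.eq]; group
    _ = _ := by rw [e, meridian, descProd]; group

/-- The generator commutes with the product of the two adjacent meridians, so its effect on the
second is forced by its effect on the first. -/
theorem gen_conj_meridian_succ {n k : ℕ} (hk : k < n - 1 - 1) :
    gen n (k + 1) * meridian n (k + 1) * (gen n (k + 1))⁻¹ =
      (meridian n (k + 1))⁻¹ * meridian n k * meridian n (k + 1) := by
  have c : Commute (gen n (k + 1)) (descProd (gen n) k) :=
    gen_commute_descProd (by omega) (by omega)
  have b := gen_braid (n := n) (i := k) (by omega)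
  have hc : Commute (gen n (k + 1)) (meridian n k * meridian n (k + 1)) := by
    have e : meridian n k * meridian n (k + 1) = (descProd (gen n) k)⁻¹ *
        (gen n k * gen n (k + 1) * (gen n (k + 1) * gen n k)) * descProd (gen n) k := by
      rw [meridian, meridian, descProd, pow_two, pow_two]; group
    have c' : Commute (gen n (k + 1))
        (gen n k * gen n (k + 1) * (gen n (k + 1) * gen n k)) := by
      change _ * _ = _ * _
      calc _ = gen n (k + 1) * gen n k * gen n (k + 1) * (gen n (k + 1) * gen n k) := by group
        _ = gen n k * gen n (k + 1) * (gen n k * gen n (k + 1) * gen n k) := by rw [← b]; group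
        _ = _ := by rw [b]; group
    rw [e]
    exact (c.inv_right.mul_right c').mul_right c
  have e1 := gen_conj_meridian_self hk
  calc _ = (gen n (k + 1) * meridian n k * (gen n (k + 1))⁻¹)⁻¹ *
        (gen n (k + 1) * (meridian n k * meridian n (k + 1)) * (gen n (k + 1))⁻¹) := by group
    _ = _ := by rw [e1, hc.eq]; group

/-- Meridians transform under shifted braids as free generators do under Artin's automorphisms; this
is the compatibility needed to map out of the semidirect product. -/
theorem meridian_equivariant {n : ℕ} (g : BraidGroup (n - 1)) (w : FreeGroup ℕ) :
    FreeGroup.lift (meridian n) (artin (n - 1) g w) =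
      shift n g * FreeGroup.lift (meridian n) w * (shift n g)⁻¹ := by
  induction g using gen_induction generalizing w with
  | gen i hi =>
    rw [artin_gen hi, shift_gen hi]
    have : (FreeGroup.lift (meridian n)).comp (artinAut i).toMonoidHom =
        (MulAut.conj (gen n (i + 1))).toMonoidHom.comp (FreeGroup.lift (meridian n)) := by
      ext q
      change FreeGroup.lift (meridian n) (artinAut i (.of q)) =
        gen n (i + 1) * FreeGroup.lift (meridian n) (.of q) * (gen n (i + 1))⁻¹
      rcases eq_or_ne q i with rfl | h
      · simp [artinAut_self, gen_conj_meridian_self hi]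
      rcases eq_or_ne q (i + 1) with rfl | h'
      · simp [artinAut_succ, gen_conj_meridian_succ hi]
      · simp only [artinAut_of_ne h h', FreeGroup.lift_apply_of,
          (gen_conj_meridian_of_ne hi h h').eq, mul_inv_cancel_right]
    exact DFunLike.congr_fun this w
  | one => simp
  | mul a b ha hb => rw [map_mul, MulAut.mul_apply, ha, hb, map_mul]; group
  | inv a ha =>
    have := ha (artin (n - 1) a⁻¹ w)
    rw [← MulAut.mul_apply, ← map_mul, mul_inv_cancel, map_one, MulAut.one_apply] at this
    rw [this, map_inv (shift n)]; group

/-- The homomorphism embedding `PointedBraid n` as the stabilizer of the first position. -/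
def ofPointed (n : ℕ) : PointedBraid n →* BraidGroup n :=
  SemidirectProduct.lift (FreeGroup.lift (meridian n)) (shift n) fun g =>
    MonoidHom.ext (meridian_equivariant g)

/-- This is where `cocycle` comes from: the descending products are coset representatives of the
stabilizer, the `p`-th one carrying position `0` to `p`. -/
theorem gen_mul_descProd {n i p : ℕ} (hi : i < n - 1) (hp : p ≤ n - 1) :
    gen n i * descProd (gen n) p =
      descProd (gen n) (adjSwap i p) * ofPointed n (cocycle n i p) := by
  rcases Nat.lt_or_ge p i with h1 | h1
  · obtain ⟨k, rfl⟩ : ∃ k, i = k + 1 := ⟨i - 1, by omega⟩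
    rw [adjSwap_of_ne (by omega) (by omega), cocycle_lt hi h1, ofPointed, lift_inr,
      add_tsub_cancel_right, shift_gen (by omega), (gen_commute_descProd h1 hi).eq]
  rcases eq_or_ne p i with rfl | h2
  · rw [adjSwap_left, cocycle_self, map_one, mul_one]; rfl
  rcases eq_or_ne p (i + 1) with rfl | h3
  · rw [adjSwap_right, cocycle_succ hi, ofPointed, lift_inl, FreeGroup.lift_apply_of, meridian,
      descProd, pow_two]
    group
  · rw [adjSwap_of_ne h2 h3, cocycle_gt hp (by omega), ofPointed, lift_inr,
      shift_gen (by omega), descProd_mul_gen (by omega) hp]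

theorem perm_le {n : ℕ} (g : BraidGroup n) {p : ℕ} : perm n g p ≤ n - 1 ↔ p ≤ n - 1 := by
  induction g using gen_induction generalizing p with
  | gen i hi =>
    rw [perm_gen hi, Equiv.swap_apply_def]
    split_ifs <;> omega
  | one => simp
  | mul a b ha hb => rw [map_mul, Equiv.Perm.mul_apply, ha, hb]
  | inv a ha => rw [← ha, ← Equiv.Perm.mul_apply, ← map_mul]; simp

theorem mul_descProd {n : ℕ} (g : BraidGroup n) {p : ℕ} (hp : p ≤ n - 1) :
    g * descProd (gen n) p =
      descProd (gen n) (perm n g p) * ofPointed n (induced n g (p, 1)).2 := by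
  induction g using gen_induction generalizing p with
  | gen i hi => rw [gen_mul_descProd hi hp, perm_gen hi, induced_gen hi, mul_one]
  | one => simp
  | mul a b ha hb =>
    rw [mul_assoc, hb hp, ← mul_assoc, ha ((perm_le b).2 hp), map_mul, map_mul,
      Equiv.Perm.mul_apply, Equiv.Perm.mul_apply, induced_apply b, mul_one,
      induced_apply a _ (Prod.snd _), mul_assoc, ← map_mul]
  | inv a ha =>
    have hq : perm n a⁻¹ p ≤ n - 1 := (perm_le _).2 hp
    have h1 : perm n a (perm n a⁻¹ p) = p := by simp
    have h2 : (induced n a (perm n a⁻¹ p, 1)).2 * (induced n a⁻¹ (p, 1)).2 = 1 := by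
      have e : induced n a (induced n a⁻¹ (p, 1)) = (p, 1) := by simp
      rw [induced_apply a⁻¹, induced_apply a, mul_one] at e
      exact congrArg Prod.snd e
    have h3 := ha hq
    rw [h1] at h3
    rw [inv_mul_eq_iff_eq_mul, ← mul_assoc, h3, mul_assoc, ← map_mul, h2, map_one, mul_one]

/-- The case `p = 0` of `mul_descProd`, where the coset representatives are trivial. It makes
`toPointed` injective on the stabilizer. -/
theorem ofPointed_toPointed {n : ℕ} {g : BraidGroup n} (hg : perm n g 0 = 0) :
    ofPointed n (toPointed g) = g := by
  have := mul_descProd g (Nat.zero_le (n - 1))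
  rw [hg] at this
  simpa [descProd, toPointed] using this.symm

theorem perm_gen_succ_zero {n i : ℕ} (hi : i + 1 < n - 1) : perm n (gen n (i + 1)) 0 = 0 := by
  rw [perm_gen hi, adjSwap_of_ne (by omega) (by omega)]

theorem toPointed_gen_succ {n i : ℕ} (hi : i + 1 < n - 1) :
    toPointed (gen n (i + 1)) = inr (gen (n - 1) i) :=
  toPointed_eq (p := 0) <| by
    rw [induced_gen hi, adjSwap_of_ne (by omega) (by omega), cocycle_lt hi (by omega), mul_one,
      add_tsub_cancel_right]

theorem induced_descProd {n t : ℕ} (ht : t ≤ n - 1) (h : PointedBraid n) :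
    induced n (descProd (gen n) t) (0, h) = (t, h) := by
  induction t with
  | zero => simp [descProd]
  | succ t ih =>
    rw [descProd, map_mul, Equiv.Perm.mul_apply, ih (by omega), induced_gen ht, adjSwap_left,
      cocycle_self, one_mul]

theorem induced_meridian {n q : ℕ} (hq : q < n - 1) :
    induced n (meridian n q) (0, 1) = (0, inl (.of q)) := by
  rw [meridian, mul_assoc, map_mul, map_inv, Equiv.Perm.mul_apply, Equiv.Perm.inv_eq_iff_eq,
    induced_descProd hq.le, map_mul, Equiv.Perm.mul_apply, induced_descProd hq.le, pow_two,
    map_mul, Equiv.Perm.mul_apply, induced_gen hq q, adjSwap_left, induced_gen hq, adjSwap_right,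
    cocycle_self, cocycle_succ hq]
  simp

theorem perm_meridian {n q : ℕ} (hq : q < n - 1) : perm n (meridian n q) 0 = 0 := by
  have := induced_meridian hq
  rw [induced_apply] at this
  exact congrArg Prod.fst this

theorem toPointed_meridian {n q : ℕ} (hq : q < n - 1) :
    toPointed (meridian n q) = inl (.of q) := toPointed_eq (induced_meridian hq)

theorem induced_ascProd {n t : ℕ} (ht : t ≤ n - 1) (h : PointedBraid n) :
    induced n (ascProd (gen n) t) (t, h) =
      (0, inl (ascProd (fun i => FreeGroup.of i) t) * h) := by
  induction t generalizing h with
  | zero => simp [ascProd]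
  | succ t ih =>
    rw [ascProd, map_mul, Equiv.Perm.mul_apply, induced_gen ht, adjSwap_right, cocycle_succ ht,
      ih (by omega), ascProd, map_mul inl, mul_assoc]

theorem induced_shift {n : ℕ} (g : BraidGroup (n - 1)) (h : PointedBraid n) :
    induced n (shift n g) (0, h) = (0, inr g * h) := by
  induction g using gen_induction generalizing h with
  | gen i hi =>
    rw [shift_gen hi, induced_zero (perm_gen_succ_zero (by omega)), toPointed_gen_succ (by omega)]
  | one => simp
  | mul a b ha hb => rw [map_mul, map_mul, Equiv.Perm.mul_apply, hb, ha, map_mul, mul_assoc]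
  | inv a ha =>
    rw [map_inv, map_inv, Equiv.Perm.inv_eq_iff_eq, ha, map_inv]; simp

theorem fundamental_sq_eq {n : ℕ} (hn : 2 ≤ n) : fundamental n ^ 2 =
    shift n (fundamental (n - 1)) * ascProd (gen n) (n - 1) * descProd (gen n) (n - 1) *
      shift n (fundamental (n - 1)) := by
  obtain ⟨m, rfl⟩ : ∃ m, n = m + 2 := ⟨n - 2, by omega⟩
  have e : shift (m + 2) (fundamental (m + 2 - 1)) =
      garside (fun i => gen (m + 2) (i + 1)) m := by
    rw [fundamental_eq, map_garside]
    exact garside_congr _ fun i hi => shift_gen (n := m + 2) hi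
  rw [e, fundamental_eq]
  exact (isSingularBraidFamily_gen (m + 2)).garside_sq (t := m) (by omega)

theorem induced_fundamental_sq {n : ℕ} (hn : 2 ≤ n) : induced n (fundamental n ^ 2) (0, 1) =
    (0, inr (fundamental (n - 1)) * (inl (ascProd (fun i => FreeGroup.of i) (n - 1)) *
      inr (fundamental (n - 1)))) := by
  rw [fundamental_sq_eq hn]
  simp only [map_mul, Equiv.Perm.mul_apply]
  rw [induced_shift, induced_descProd le_rfl, induced_ascProd le_rfl, induced_shift, mul_one]

theorem perm_fundamental_sq {n : ℕ} (hn : 2 ≤ n) : perm n (fundamental n ^ 2) 0 = 0 := by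
  have := induced_fundamental_sq hn
  rw [induced_apply] at this
  exact congrArg Prod.fst this

theorem toPointed_fundamental_sq_right {n : ℕ} (hn : 2 ≤ n) :
    (toPointed (fundamental n ^ 2)).right = fundamental (n - 1) ^ 2 := by
  rw [toPointed_eq (induced_fundamental_sq hn)]
  simp [pow_two]

/-- Braids fixing the first position. -/
def firstStabilizer (n : ℕ) : Subgroup (BraidGroup n) where
  carrier := {g | perm n g 0 = 0}
  one_mem' := by simp
  mul_mem' {a b} ha hb := by
    simp only [Set.mem_ofPred_eq] at *
    rw [map_mul, Equiv.Perm.mul_apply, hb, ha]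
  inv_mem' {a} ha := by
    simp only [Set.mem_ofPred_eq] at *
    rw [map_inv, Equiv.Perm.inv_eq_iff_eq, ha]

/-- `toPointed` as a homomorphism. -/
def toPointedHom (n : ℕ) : firstStabilizer n →* PointedBraid n where
  toFun g := toPointed g.1
  map_one' := by simp [toPointed]
  map_mul' a b := toPointed_mul _ b.2

theorem mem_zpowers_gen_two (g : BraidGroup 2) : g ∈ Subgroup.zpowers (gen 2 0) := by
  induction g using gen_induction with
  | gen i hi =>
    obtain rfl : i = 0 := by omega
    exact Subgroup.mem_zpowers _
  | one => exact one_mem _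
  | mul a b ha hb => exact mul_mem ha hb
  | inv a ha => exact inv_mem ha

/-- A braid on two strings fixing the first position is a power of `Δ ^ 2`. -/
theorem mem_zpowers_two {z : BraidGroup 2} (hz : perm 2 z 0 = 0) :
    z ∈ Subgroup.zpowers (fundamental 2 ^ 2) := by
  have hf : fundamental 2 = gen 2 0 := by simp [fundamental_eq, garside, ascProd]
  obtain ⟨k, rfl⟩ := mem_zpowers_gen_two z
  have hsq : perm 2 (gen 2 0) ^ 2 = 1 := by
    rw [perm_gen (by omega), pow_two, Equiv.swap_mul_self]
  rcases Int.even_or_odd' k with ⟨l, rfl | rfl⟩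
  · exact ⟨l, by simp only [hf]; rw [zpow_mul]; norm_cast⟩
  · exfalso
    simp only at hz
    have h2 : perm 2 (gen 2 0) ^ (2 : ℤ) = 1 := by exact_mod_cast hsq
    rw [map_zpow, zpow_add, zpow_mul, h2, one_zpow, one_mul, zpow_one, perm_gen (by omega),
      adjSwap_left] at hz
    omega

end BraidGroup

/-! ### The center of the braid group -/

namespace BraidGroup

open SemidirectProduct

theorem toPointed_commute {n : ℕ} {y z : BraidGroup n} (h : Commute y z) (hy : perm n y 0 = 0)
    (hz : perm n z 0 = 0) : Commute (toPointed y) (toPointed z) := by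
  change _ * _ = _ * _
  rw [← toPointed_mul _ hz, h.eq, toPointed_mul _ hy]

/-- The image of `0` is fixed by all transpositions of adjacent positions in `1, …, n - 1`, and for
`n ≥ 3` each of those positions is moved by one of them. -/
theorem perm_zero_of_mem_center {n : ℕ} (hn : 3 ≤ n) {z : BraidGroup n}
    (hz : z ∈ Subgroup.center (BraidGroup n)) : perm n z 0 = 0 := by
  have hfix (i : ℕ) (hi : i + 1 < n - 1) : adjSwap (i + 1) (perm n z 0) = perm n z 0 := by
    have := congrArg (fun g => perm n g 0) (Subgroup.mem_center_iff.1 hz (gen n (i + 1)))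
    simp only [map_mul, Equiv.Perm.mul_apply] at this
    rwa [perm_gen_succ_zero hi, perm_gen hi] at this
  have hle : perm n z 0 ≤ n - 1 := (perm_le z).2 (by omega)
  by_contra hne
  obtain ⟨p, hp⟩ := Nat.exists_eq_succ_of_ne_zero hne
  rw [hp] at hfix hle
  rcases p with _ | p
  · have := hfix 0 (by omega)
    rw [Equiv.swap_apply_left] at this
    omega
  · have := hfix p (by omega)
    rw [Equiv.swap_apply_right] at this
    omega

/-- The condition on the first position lets the induction start at `n = 2`: there every braid is
central, but only the even powers of the generator are powers of `Δ ^ 2`. -/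
theorem mem_zpowers_of_mem_center (n : ℕ) (hn : 2 ≤ n) (z : BraidGroup n)
    (hz : z ∈ Subgroup.center (BraidGroup n)) (hp : perm n z 0 = 0) :
    z ∈ Subgroup.zpowers (fundamental n ^ 2) := by
  induction n using Nat.strong_induction_on with
  | _ n ih =>
  obtain rfl | hn3 := hn.eq_or_lt
  · exact mem_zpowers_two hp
  have hcomm (y z : BraidGroup n) (hz : z ∈ Subgroup.center (BraidGroup n)) : Commute y z :=
    Subgroup.mem_center_iff.1 hz y
  have hb : (toPointed z).right ∈ Subgroup.center (BraidGroup (n - 1)) := by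
    refine mem_center_of_gen fun i hi => ?_
    have := toPointed_commute (hcomm (gen n (i + 1)) z hz) (perm_gen_succ_zero (by omega)) hp
    rw [toPointed_gen_succ (by omega)] at this
    simpa using (this.map rightHom).symm
  -- Commuting with the first meridian makes the Artin automorphism of the right component send the
  -- first free generator to a conjugate of itself, which determines the permutation there.
  have hbp : perm (n - 1) (toPointed z).right 0 = 0 := by
    have := toPointed_commute (hcomm (meridian n 0) z hz) (perm_meridian (by omega)) hp
    rw [toPointed_meridian (by omega)] at this
    have h1 := congrArg SemidirectProduct.left this.eq
    simp only [mul_left, left_inl, right_inl, map_one, MulAut.one_apply] at h1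
    refine FreeGroup.of_eq_of_isConj ((isConj_artin _ 0).symm.trans (isConj_iff.2
      ⟨(toPointed z).left, ?_⟩))
    rw [← h1, mul_inv_cancel_right]
  obtain ⟨k, hk⟩ := ih (n - 1) (by omega) (by omega) _ hb hbp
  simp only at hk
  let D : firstStabilizer n := ⟨fundamental n ^ 2, perm_fundamental_sq hn⟩
  -- The quotient is again central, and its component in the smaller braid group has been cancelled.
  let y : firstStabilizer n := ⟨z, hp⟩ * (D ^ k)⁻¹
  have hyc : (y : BraidGroup n) ∈ Subgroup.center (BraidGroup n) :=
    mul_mem hz (inv_mem (zpow_mem (fundamental_sq_mem_center n) k))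
  have hyr : (toPointed (y : BraidGroup n)).right = 1 := by
    change (rightHom.comp (toPointedHom n)) y = 1
    rw [map_mul, map_inv, map_zpow, mul_inv_eq_one]
    change (toPointed z).right = (toPointed (fundamental n ^ 2)).right ^ k
    rw [toPointed_fundamental_sq_right hn, hk]
  have hyl : toPointed (y : BraidGroup n) = inl (toPointed (y : BraidGroup n)).left :=
    SemidirectProduct.ext (by simp) (by simpa using hyr)
  have hcl (q : ℕ) (hq : q < n - 1) :
      Commute (toPointed (y : BraidGroup n)).left (FreeGroup.of q) := by
    have := toPointed_commute (hcomm (meridian n q) y hyc) (perm_meridian hq) y.2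
    rw [toPointed_meridian hq, hyl] at this
    exact (Commute.of_map inl_injective this).symm
  have h1 := FreeGroup.eq_one_of_commute_of (zero_ne_one) (hcl 0 (by omega)) (hcl 1 (by omega))
  have h2 : (y : BraidGroup n) = 1 := by
    rw [← ofPointed_toPointed y.2, hyl, h1, map_one, map_one]
  exact ⟨k, (mul_inv_eq_one.1 h2).symm⟩

/-- The center of the braid group on at least three strings. -/
theorem center_eq_zpowers {n : ℕ} (hn : 3 ≤ n) :
    Subgroup.center (BraidGroup n) = Subgroup.zpowers (fundamental n ^ 2) := by
  refine le_antisymm (fun z hz => ?_) ?_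
  · exact mem_zpowers_of_mem_center n (by omega) z hz (perm_zero_of_mem_center hn hz)
  · rw [Subgroup.zpowers_le]
    exact fundamental_sq_mem_center n

/-- The square of the first generator is the meridian `0`, and meridians `0` and `1` become distinct
free generators. -/
theorem not_commute_meridian_pow {n N : ℕ} (hn : 3 ≤ n) (hN : N ≠ 0) :
    ¬ Commute (meridian n 1 ^ N) (gen n 0) := by
  intro h
  have h0 : meridian n 0 = gen n 0 ^ 2 := by simp [meridian, descProd]
  have h1 := h.pow_right 2
  rw [← h0] at h1
  let a : firstStabilizer n := ⟨meridian n 1, perm_meridian (by omega)⟩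
  let b : firstStabilizer n := ⟨meridian n 0, perm_meridian (by omega)⟩
  have h2 : Commute (a ^ N) b := Subtype.ext h1
  have h3 := h2.map (toPointedHom n)
  rw [map_pow] at h3
  change Commute (toPointed (meridian n 1) ^ N) (toPointed (meridian n 0)) at h3
  rw [toPointed_meridian (by omega), toPointed_meridian (by omega), ← map_pow] at h3
  exact FreeGroup.not_commute_of_pow one_ne_zero hN (Commute.of_map inl_injective h3)

theorem gen_isConj_gen_zero {n i : ℕ} (hi : i < n - 1) :
    ∃ g, g * gen n 0 * g⁻¹ = gen n i := by
  induction i with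
  | zero => exact ⟨1, by simp⟩
  | succ i ih =>
    obtain ⟨g, hg⟩ := ih (by omega)
    refine ⟨gen n i * gen n (i + 1) * g, ?_⟩
    calc _ = gen n i * gen n (i + 1) * (g * gen n 0 * g⁻¹) * (gen n i * gen n (i + 1))⁻¹ := by
          group
      _ = _ := by rw [hg, gen_braid hi]; group

end BraidGroup

/-! ### Homomorphisms out of the singular braid monoid -/

namespace SingularBraidMonoid

open BraidGroup (gen)

/-- The singular generator `x_i`. -/
def singular {n : ℕ} (i : Fin (n - 1)) : SingularBraidMonoid n :=
  PresentedMonoid.mk (SingularBraidRel n) (SingularBraidGen.wX i)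

theorem ofBraid_sigma {n : ℕ} (i : Fin (n - 1)) : ofBraid n (BraidGroup.sigma i) =
    PresentedMonoid.mk (SingularBraidRel n) (SingularBraidGen.wS i) := by
  change ((PresentedGroup.toGroup lift_sigmaUnit_eq_one (PresentedGroup.of i) :
    (SingularBraidMonoid n)ˣ) : SingularBraidMonoid n) = _
  rw [PresentedGroup.toGroup.of]
  rfl

theorem ofBraid_sigma_inv {n : ℕ} (i : Fin (n - 1)) : ofBraid n (BraidGroup.sigma i)⁻¹ =
    PresentedMonoid.mk (SingularBraidRel n) (SingularBraidGen.wSInv i) := by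
  change ((PresentedGroup.toGroup lift_sigmaUnit_eq_one (PresentedGroup.of i)⁻¹ :
    (SingularBraidMonoid n)ˣ) : SingularBraidMonoid n) = _
  rw [map_inv, PresentedGroup.toGroup.of]
  rfl

@[elab_as_elim]
theorem gen_induction {n : ℕ} {p : SingularBraidMonoid n → Prop} (z : SingularBraidMonoid n)
    (one : p 1) (braid : ∀ g z, p z → p (ofBraid n g * z))
    (singular : ∀ i z, p z → p (singular i * z)) : p z := by
  induction z using PresentedMonoid.inductionOn with
  | h w =>
  induction w using FreeMonoid.inductionOn' with
  | one => exact one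
  | of_mul a w ih =>
    rw [map_mul]
    rcases a with i | i | i
    · have := braid (BraidGroup.sigma i) _ ih
      rwa [ofBraid_sigma] at this
    · have := braid (BraidGroup.sigma i)⁻¹ _ ih
      rwa [ofBraid_sigma_inv] at this
    · exact singular i _ ih

/-- The homomorphism from the singular braid monoid extending a homomorphism of the braid group
by prescribed values of the singular generators. -/
def lift {n : ℕ} {M : Type*} [Monoid M] (f : BraidGroup n →* M) (x : Fin (n - 1) → M)
    (hcomm : ∀ i j : Fin (n - 1), 1 < |(i : ℤ) - (j : ℤ)| → x i * x j = x j * x i)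
    -- Every relation mixing `σ` and `x` has this shape: `g = σ_j` gives the commutations, and
    -- products of two adjacent generators give the slides.
    (hconj : ∀ (i j : Fin (n - 1)) (g : BraidGroup n),
      g * BraidGroup.sigma i = BraidGroup.sigma j * g → f g * x i = x j * f g) :
    SingularBraidMonoid n →* M :=
  PresentedMonoid.lift
    (fun a => match a with
      | .sigma i => f (BraidGroup.sigma i)
      | .sigmaInv i => f (BraidGroup.sigma i)⁻¹
      | .x i => x i)
    (by
      have hg (i : Fin (n - 1)) : BraidGroup.sigma i = gen n i := (BraidGroup.gen_val i).symm
      have hc (i j : Fin (n - 1)) (h : 1 < |(i : ℤ) - (j : ℤ)|) :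
          (BraidGroup.sigma i * BraidGroup.sigma j : BraidGroup n) =
            BraidGroup.sigma j * BraidGroup.sigma i := by
        rw [hg, hg]
        rcases lt_abs.1 h with h | h
        · exact (BraidGroup.gen_comm (by omega) i.2).symm
        · exact BraidGroup.gen_comm (by omega) j.2
      have hb (i j : Fin (n - 1)) (h : (i : ℕ) + 1 = (j : ℕ)) :
          (BraidGroup.sigma i * BraidGroup.sigma j * BraidGroup.sigma i : BraidGroup n) =
            BraidGroup.sigma j * BraidGroup.sigma i * BraidGroup.sigma j := by
        rw [hg, hg, ← h]
        exact BraidGroup.gen_braid (by omega)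
      rintro a b (⟨i, j, h⟩ | ⟨i, j, h⟩ | ⟨i, j, h⟩ | ⟨i, j, h⟩ | ⟨i, j, h⟩ | ⟨i, j, h⟩ | i | i)
      · simp only [SingularBraidGen.wS, map_mul, FreeMonoid.lift_eval_of]
        rw [← map_mul, hc i j h, map_mul]
      · simp only [SingularBraidGen.wX, map_mul, FreeMonoid.lift_eval_of]
        exact hcomm i j h
      · simp only [SingularBraidGen.wX, SingularBraidGen.wS, map_mul, FreeMonoid.lift_eval_of]
        refine (hconj i i _ ?_).symm
        rcases eq_or_ne i j with rfl | hij
        · rfl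
        · refine hc j i ?_
          have : ((j : ℤ) - (i : ℤ)) ≠ 0 := fun e => hij (Fin.ext (by omega))
          have := abs_pos.2 this
          rw [abs_sub_comm] at h
          omega
      · simp only [SingularBraidGen.wS, map_mul, FreeMonoid.lift_eval_of]
        simp only [← map_mul, hb i j h]
      · simp only [SingularBraidGen.wX, SingularBraidGen.wS, map_mul, FreeMonoid.lift_eval_of]
        rw [mul_assoc (x j), ← map_mul]
        exact hconj i j _ (by rw [hb i j h, mul_assoc])
      · simp only [SingularBraidGen.wX, SingularBraidGen.wS, map_mul, FreeMonoid.lift_eval_of]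
        rw [mul_assoc (x i), ← map_mul]
        exact hconj j i _ (by rw [← hb i j h, mul_assoc])
      · simp only [SingularBraidGen.wSInv, SingularBraidGen.wS, map_mul, FreeMonoid.lift_eval_of]
        rw [← map_mul]; simp
      · simp only [SingularBraidGen.wSInv, SingularBraidGen.wS, map_mul, FreeMonoid.lift_eval_of]
        rw [← map_mul]; simp)

section lift

variable {n : ℕ} {M : Type*} [Monoid M] {f : BraidGroup n →* M} {x : Fin (n - 1) → M}
  {hcomm : ∀ i j : Fin (n - 1), 1 < |(i : ℤ) - (j : ℤ)| → x i * x j = x j * x i}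
  {hconj : ∀ (i j : Fin (n - 1)) (g : BraidGroup n),
    g * BraidGroup.sigma i = BraidGroup.sigma j * g → f g * x i = x j * f g}

theorem lift_ofBraid (g : BraidGroup n) : lift f x hcomm hconj (ofBraid n g) = f g := by
  induction g using BraidGroup.gen_induction with
  | gen i hi =>
    rw [gen, dif_pos hi, ofBraid_sigma]
    rfl
  | one => simp
  | mul a b ha hb => rw [map_mul, map_mul, ha, hb, map_mul]
  | inv a ha =>
    calc lift f x hcomm hconj (ofBraid n a⁻¹)
        = lift f x hcomm hconj (ofBraid n a⁻¹) * (f a * f a⁻¹) := by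
          rw [← map_mul, mul_inv_cancel, map_one, mul_one]
      _ = f a⁻¹ := by
          rw [← mul_assoc, ← ha, ← map_mul, ← map_mul, inv_mul_cancel, map_one, map_one, one_mul]

end lift

/-- Deleting the singular generators gives a left inverse. -/
theorem ofBraid_injective (n : ℕ) : Function.Injective (ofBraid n) :=
  Function.LeftInverse.injective (g := lift (MonoidHom.id _) (fun _ => 1) (fun _ _ _ => rfl)
    (fun _ _ _ _ => by simp)) fun g => lift_ofBraid g

/-! ### The action on sets of braids and the center of `SB_n` -/

/-- The conjugation action of the braid group on its subsets. -/
def conjSet (n : ℕ) : BraidGroup n →* Function.End (Set (BraidGroup n)) where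
  toFun g S := MulAut.conj g '' S
  map_one' := by funext S; simp; rfl
  map_mul' a b := by
    funext S
    change _ = MulAut.conj a '' (MulAut.conj b '' S)
    rw [Set.image_image, map_mul]
    rfl

/-- The action of the singular braid monoid on sets of braids: braids act by conjugation, and the
singular generator `x_i` inserts `σ_i`. -/
def insertAction (n : ℕ) : SingularBraidMonoid n →* Function.End (Set (BraidGroup n)) :=
  lift (conjSet n) (fun i => (insert (BraidGroup.sigma i) : Set _ → Set _))
    (fun _ _ _ => funext fun _ => Set.insert_comm _ _ _)
    (fun i j g h => funext fun S => by
      change MulAut.conj g '' insert _ S = insert _ (MulAut.conj g '' S)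
      rw [Set.image_insert_eq, MulAut.conj_apply, h, mul_inv_cancel_right])

theorem insertAction_ofBraid {n : ℕ} (g : BraidGroup n) (S : Set (BraidGroup n)) :
    insertAction n (ofBraid n g) S = MulAut.conj g '' S :=
  congrFun (f := insertAction n (ofBraid n g)) (g := conjSet n g)
    (lift_ofBraid (M := Function.End (Set (BraidGroup n))) g) S

theorem insertAction_singular {n : ℕ} (i : Fin (n - 1)) (S : Set (BraidGroup n)) :
    insertAction n (singular i) S = insert (BraidGroup.sigma i) S := rfl

theorem insertAction_mul {n : ℕ} (y z : SingularBraidMonoid n) (S : Set (BraidGroup n)) :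
    insertAction n (y * z) S = insertAction n y (insertAction n z S) := by
  rw [map_mul]; rfl

theorem insertAction_finite {n : ℕ} (z : SingularBraidMonoid n) :
    (insertAction n z ∅).Finite := by
  induction z using gen_induction with
  | one => rw [map_one]; exact Set.finite_empty
  | braid g z ih => rw [insertAction_mul, insertAction_ofBraid]; exact ih.image _
  | singular i z ih => rw [insertAction_mul, insertAction_singular]; exact ih.insert _

/-- A singular letter inserts a generator, all generators are conjugate, and letters further to the
left only conjugate the set or enlarge it. -/
theorem mem_range_or_exists_conj_mem {n : ℕ} (z : SingularBraidMonoid n) :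
    z ∈ Set.range (ofBraid n) ∨ ∃ g, g * gen n 0 * g⁻¹ ∈ insertAction n z ∅ := by
  induction z using gen_induction with
  | one => exact .inl ⟨1, map_one _⟩
  | braid g z ih =>
    rcases ih with ⟨a, rfl⟩ | ⟨a, ha⟩
    · exact .inl ⟨g * a, map_mul _ _ _⟩
    · refine .inr ⟨g * a, ?_⟩
      rw [insertAction_mul, insertAction_ofBraid]
      exact ⟨_, ha, by rw [MulAut.conj_apply]; group⟩
  | singular i z ih =>
    obtain ⟨g, hg⟩ := BraidGroup.gen_isConj_gen_zero (n := n) i.2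
    refine .inr ⟨g, ?_⟩
    rw [insertAction_mul, insertAction_singular, hg, BraidGroup.gen_val]
    exact Set.mem_insert _ _

theorem center_le_range {n : ℕ} (hn : 3 ≤ n) {z : SingularBraidMonoid n}
    (hz : z ∈ Submonoid.center (SingularBraidMonoid n)) : z ∈ Set.range (ofBraid n) := by
  rcases mem_range_or_exists_conj_mem z with h | ⟨g, hg⟩
  · exact h
  exfalso
  -- Centrality lets the braid act on `∅` first, where conjugation does nothing.
  have hinv (a : BraidGroup n) : MulAut.conj a '' insertAction n z ∅ = insertAction n z ∅ := by
    rw [← insertAction_ofBraid, ← insertAction_mul, Submonoid.mem_center_iff.1 hz,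
      insertAction_mul, insertAction_ofBraid, Set.image_empty]
  have hmem (a : BraidGroup n) : a * gen n 0 * a⁻¹ ∈ insertAction n z ∅ := by
    rw [← hinv (a * g⁻¹)]
    exact ⟨_, hg, by rw [MulAut.conj_apply]; group⟩
  let A := BraidGroup.meridian n 1
  -- Two equal conjugates would make a positive power of the meridian commute with the first
  -- generator.
  have hinj : Function.Injective fun N : ℕ => A ^ N * gen n 0 * (A ^ N)⁻¹ := by
    intro a b hab
    wlog hlt : a < b generalizing a b
    · rcases eq_or_lt_of_le (not_lt.1 hlt) with h | h
      · exact h.symm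
      · exact (this hab.symm h).symm
    obtain ⟨k, rfl⟩ := Nat.exists_eq_add_of_lt hlt
    refine absurd ?_ (BraidGroup.not_commute_meridian_pow hn (Nat.succ_ne_zero k))
    change A ^ (k + 1) * gen n 0 = gen n 0 * A ^ (k + 1)
    simp only [add_assoc, pow_add A a, mul_inv_rev] at hab
    rw [← mul_inv_eq_iff_eq_mul]
    have h2 := congrArg (fun g => (A ^ a)⁻¹ * g * A ^ a) hab
    simp only [mul_assoc, inv_mul_cancel_left, inv_mul_cancel, mul_one] at h2
    rw [mul_assoc]
    exact h2.symm
  exact Set.infinite_of_injective_forall_mem hinj (fun N => hmem (A ^ N)) (insertAction_finite z)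

theorem commute_ofBraid_inv {n : ℕ} {g : BraidGroup n} {y : SingularBraidMonoid n}
    (h : Commute (ofBraid n g) y) : Commute (ofBraid n g⁻¹) y := by
  have h1 : ofBraid n g⁻¹ * ofBraid n g = 1 := by rw [← map_mul]; simp
  have h2 : ofBraid n g * ofBraid n g⁻¹ = 1 := by rw [← map_mul]; simp
  change _ * _ = _ * _
  calc ofBraid n g⁻¹ * y = ofBraid n g⁻¹ * (y * ofBraid n g) * ofBraid n g⁻¹ := by
        rw [mul_assoc, mul_assoc, h2, mul_one]
    _ = y * ofBraid n g⁻¹ := by rw [← h.eq, ← mul_assoc, h1, one_mul]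

theorem commute_ofBraid_zpow {n : ℕ} {g : BraidGroup n} {y : SingularBraidMonoid n}
    (h : Commute (ofBraid n g) y) (k : ℤ) : Commute (ofBraid n (g ^ k)) y := by
  cases k with
  | ofNat k => simpa using h.pow_left k
  | negSucc k =>
    rw [zpow_negSucc]
    apply commute_ofBraid_inv
    rw [map_pow]
    exact h.pow_left _

/-- The singular generators indexed by natural numbers; trivial out of range. -/
def singularNat (n i : ℕ) : SingularBraidMonoid n :=
  if h : i < n - 1 then singular ⟨i, h⟩ else 1

theorem isSingularBraidFamily (n : ℕ) :
    IsSingularBraidFamily (n - 1) (fun i => ofBraid n (gen n i)) (singularNat n) where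
  comm i j h hj := by rw [← map_mul, BraidGroup.gen_comm h hj, map_mul]
  xcomm i j h hi hj := by
    rw [singularNat, dif_pos hi, gen, dif_pos hj, ofBraid_sigma, singular, ← map_mul, ← map_mul]
    refine mk_eq_mk (SingularBraidRel.x_sigma_comm _ _ fun e => ?_)
    rcases (abs_eq zero_le_one).1 e with e | e <;> simp only at e <;> omega
  slide_right i h := by
    have hi : i < n - 1 := by omega
    rw [singularNat, singularNat, dif_pos hi, dif_pos h, gen, gen, dif_pos hi, dif_pos h,
      ofBraid_sigma, ofBraid_sigma, singular, singular]
    simp only [← map_mul]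
    exact mk_eq_mk (SingularBraidRel.slide_right _ _ rfl)
  slide_left i h := by
    have hi : i < n - 1 := by omega
    rw [singularNat, singularNat, dif_pos hi, dif_pos h, gen, gen, dif_pos hi, dif_pos h,
      ofBraid_sigma, ofBraid_sigma, singular, singular]
    simp only [← map_mul]
    exact mk_eq_mk (SingularBraidRel.slide_left _ _ rfl)

/-- Commuting with the `x_i` is not formal: it rests on the center of `Br_n` being generated by `Δ ^
2`, which commutes with them by Garside's computation in `SB_n`. -/
theorem ofBraid_mem_center {n : ℕ} (hn : 3 ≤ n) {g : BraidGroup n}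
    (hg : g ∈ Subgroup.center (BraidGroup n)) :
    ofBraid n g ∈ Submonoid.center (SingularBraidMonoid n) := by
  have hsing (i : Fin (n - 1)) : Commute (ofBraid n g) (singular i) := by
    rw [BraidGroup.center_eq_zpowers hn] at hg
    have hD : Commute (ofBraid n (BraidGroup.fundamental n ^ 2)) (singular i) := by
      have := (isSingularBraidFamily n).commute_garside_sq i.2
      rw [singularNat, dif_pos i.2, ← map_garside, ← BraidGroup.fundamental_eq, ← map_pow] at this
      exact this
    obtain ⟨k, rfl⟩ := hg
    exact commute_ofBraid_zpow hD k
  rw [Submonoid.mem_center_iff]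
  intro z
  induction z using gen_induction with
  | one => rw [one_mul, mul_one]
  | braid a z ih =>
    have : Commute (ofBraid n a) (ofBraid n g) :=
      Commute.map (Subgroup.mem_center_iff.1 hg a) (ofBraid n)
    exact this.mul_left ih
  | singular i z ih => exact (hsing i).symm.mul_left ih

theorem center_eq_map {n : ℕ} (hn : 3 ≤ n) : Submonoid.center (SingularBraidMonoid n) =
    (Subgroup.center (BraidGroup n)).toSubmonoid.map (ofBraid n) := by
  ext z
  constructor
  · intro hz
    obtain ⟨g, rfl⟩ := center_le_range hn hz
    refine ⟨g, Subgroup.mem_center_iff.2 fun a => ofBraid_injective n ?_, rfl⟩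
    rw [map_mul, map_mul]
    exact Submonoid.mem_center_iff.1 hz _
  · rintro ⟨g, hg, rfl⟩
    exact ofBraid_mem_center hn hg

/-! ### The monoid on two strings -/

/-- The exponent sum of `σ` and the number of singular points on two strings. -/
def degreeTwo : SingularBraidMonoid 2 →* Multiplicative (ℤ × ℕ) :=
  lift (BraidGroup.lift (fun _ => Multiplicative.ofAdd (1 : ℤ)) (fun _ _ _ _ => rfl)
      (fun _ _ => rfl) |> ((AddMonoidHom.inl ℤ ℕ).toMultiplicative).comp)
    (fun _ => Multiplicative.ofAdd (0, 1)) (fun _ _ _ => rfl) (fun _ _ _ _ => mul_comm _ _)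

theorem exists_eq_zpow_mul_pow (z : SingularBraidMonoid 2) :
    ∃ (k : ℤ) (l : ℕ), z = ofBraid 2 (gen 2 0 ^ k) * singularNat 2 0 ^ l := by
  have hx : Commute (ofBraid 2 (gen 2 0)) (singularNat 2 0) :=
    ((isSingularBraidFamily 2).xcomm 0 0 (by omega) (by omega) (by omega)).symm
  induction z using gen_induction with
  | one => exact ⟨0, 0, by simp⟩
  | braid g z ih =>
    obtain ⟨k, l, rfl⟩ := ih
    obtain ⟨j, rfl⟩ := BraidGroup.mem_zpowers_gen_two g
    exact ⟨j + k, l, by simp only; rw [zpow_add, map_mul, mul_assoc]⟩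
  | singular i z ih =>
    obtain ⟨k, l, rfl⟩ := ih
    have hi : singular i = singularNat 2 0 := by
      rw [singularNat, dif_pos (by omega)]
      congr 1
      exact Fin.ext (by omega)
    have hc := commute_ofBraid_zpow hx k
    exact ⟨k, l + 1, by rw [hi, ← mul_assoc, ← hc.eq, mul_assoc, ← pow_succ']⟩

theorem degreeTwo_zpow_mul_pow (k : ℤ) (l : ℕ) :
    degreeTwo (ofBraid 2 (gen 2 0 ^ k) * singularNat 2 0 ^ l) = Multiplicative.ofAdd (k, l) := by
  have h1 : degreeTwo (ofBraid 2 (gen 2 0 ^ k)) = Multiplicative.ofAdd (k, 0) := by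
    rw [degreeTwo, lift_ofBraid, MonoidHom.comp_apply, map_zpow, BraidGroup.lift_gen (by omega),
      ← ofAdd_zsmul]
    simp
  have h2 : degreeTwo (singularNat 2 0) = Multiplicative.ofAdd (0, 1) := rfl
  rw [map_mul, map_pow, h1, h2, ← ofAdd_nsmul, ← ofAdd_add]
  simp

/-- Every element has the normal form `σ ^ k * x ^ l`, and `degreeTwo` reads off both exponents. -/
theorem degreeTwo_bijective : Function.Bijective degreeTwo := by
  constructor
  · intro a b h
    obtain ⟨k, l, rfl⟩ := exists_eq_zpow_mul_pow a
    obtain ⟨k', l', rfl⟩ := exists_eq_zpow_mul_pow b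
    rw [degreeTwo_zpow_mul_pow, degreeTwo_zpow_mul_pow] at h
    obtain ⟨rfl, rfl⟩ := Prod.mk.inj (Multiplicative.ofAdd.injective h)
    rfl
  · intro y
    exact ⟨_, degreeTwo_zpow_mul_pow (Multiplicative.toAdd y).1 (Multiplicative.toAdd y).2⟩

end SingularBraidMonoid

theorem mainTheorem5 :
    ((∀ a b : SingularBraidMonoid 2, a * b = b * a) ∧
      Nonempty (SingularBraidMonoid 2 ≃* Multiplicative (ℤ × ℕ))) ∧
    ∀ n : ℕ, 3 ≤ n →
      Function.Injective (SingularBraidMonoid.ofBraid n) ∧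
      Submonoid.center (SingularBraidMonoid n) =
        (Subgroup.center (BraidGroup n)).toSubmonoid.map (SingularBraidMonoid.ofBraid n) ∧
      Subgroup.center (BraidGroup n) = Subgroup.zpowers (BraidGroup.fundamental n ^ 2) ∧
      Submonoid.center (SingularBraidMonoid n) =
        (Subgroup.zpowers (BraidGroup.fundamental n ^ 2)).toSubmonoid.map
          (SingularBraidMonoid.ofBraid n) := by
  refine ⟨⟨fun a b => SingularBraidMonoid.degreeTwo_bijective.1 ?_,
    ⟨MulEquiv.ofBijective _ SingularBraidMonoid.degreeTwo_bijective⟩⟩, fun n hn =>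
    ⟨SingularBraidMonoid.ofBraid_injective n, SingularBraidMonoid.center_eq_map hn,
      BraidGroup.center_eq_zpowers hn, ?_⟩⟩
  · rw [map_mul, map_mul, mul_comm]
  · rw [SingularBraidMonoid.center_eq_map hn, BraidGroup.center_eq_zpowers hn]
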